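/- Let $A\in\mathbb R^{N\times N}$ be the state matrix of a linear network $\dot{\mathbf x}=A\mathbf x+B\mathbf u$, $\mathbf y=C\mathbf x$, let $D=(V,E)$ be its digraph, which has an arc $v_j\to v_i$ exactly when $A_{ij}\neq 0$, and let $S\subseteq V$ be a target set; $C$ consists of the rows of the identity matrix indexed by $S$. For an input matrix $B\in\mathbb R^{N\times M}$ with $M$ control sources, $S$ is called structurally (target) controllable for $(A,B,C)$ if there are real matrices $A',B'$ with the same positions of zero entries as $A$ and $B$, respectively, such that $\operatorname{rank}[CB',CA'B',\dots,CA'^{\,N-1}B']=|S|$. The node-split network $D'$ has the vertices $v_s$, $v_t$ and $v^{in},v^{out}$ for all $v\in V$, and the arcs $v_t\to v_s$ (upper bound $\infty$), and $v_s\to v^{in}$, $v^{out}\to v_t$, $v^{in}\to v^{out}$ for all $v\in V$, and $u^{out}\to v^{in}$ for all $(u,v)\in E$ (upper bound $1$ each). The lower bound is $1$ on $v^{in}\to v^{out}$ for $v\in S$ and $0$ on all other arcs. A feasible circulation of $D'$ is a real function $f$ on the arcs that is conserved at every vertex (including $v_s$ and $v_t$) and lies between the lower and the upper bounds. **Theorem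 1.** Let $f$ be a feasible circulation of $D'$. Then there are a finite set $P$ of simple directed paths (control paths; a single node is allowed) and a finite set $\mathcal C$ of simple directed circles of $D$ such that every node lies at most once on $P\cup\mathcal C$, every node of $S$ lies on $P\cup\mathcal C$, and the following hold. (i) Turn each path $v_1\dots v_p$ of $P$ into $v_sv_1^{in}v_1^{out}\dots v_p^{in}v_p^{out}v_tv_s$ and each circle $v_1\dots v_cv_1$ of $\mathcal C$ into $v_1^{in}v_1^{out}\dots v_c^{in}v_c^{out}v_1^{in}$. Then the number $g(e)$ of times that an arc $e$ of $D'$ is traversed satisfies $\lfloor f(e)\rfloor\le g(e)\le\lceil f(e)\rceil$. In particular, if $f$ is integral, then $g=f$, and $|P|=f(v_t,v_s)$. (ii) Say that the control sources of $B$ are attached to $P\cup\mathcal C$ if the first node of each path in $P$ is connected to a control source of its own (source $m$ is connected to node $v_i$ if $B_{im}\ne0$; different paths get different sources, and a source may be connected to further nodes), and every node on a circle in $\mathcal C$ can be reached from some control source along a directed path of the digraph $G(A,B)$, which is $D$ with the sources and their connections added. Then there is such a $B$ with $\max\{|P|,1\}$ control sources; and for every $M$ and every $B\in\mathbb R^{N\times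 M}$ whose control sources are attached to $P\cup\mathcal C$, the set $S$ is structurally (target) controllable for $(A,B,C)$. -/

import Mathlib

noncomputable section

namespace TargetControl

open Matrix

/-! ### Linear systems and target controllability -/

section Systems

variable {V : Type*} [Fintype V] [DecidableEq V] {ι : Type*} [Fintype ι]

/-- The digraph `D(V, E)` of a state matrix for `ẋ = A x + B u`: there is an arc `j → i` exactly
when `A i j ≠ 0`, i.e. when the state `x j` acts on `x i`. -/
def stateDigraph (A : Matrix V V ℝ) : Digraph V where
  Adj j i := A i j ≠ 0

/-- The digraph `G(A, B)`: the digraph of `A`, one additional vertex for each control source, and an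
arc from the source `m` to the node `i` exactly when `B i m ≠ 0`. -/
def systemDigraph (A : Matrix V V ℝ) (B : Matrix V ι ℝ) : Digraph (V ⊕ ι) where
  Adj
    | .inl j, .inl i => (stateDigraph A).Adj j i
    | .inr m, .inl i => B i m ≠ 0
    | _, .inr _ => False

/-- A node is accessible if some directed path of `G(A, B)` leads to it from a control source. -/
def Accessible (A : Matrix V V ℝ) (B : Matrix V ι ℝ) (v : V) : Prop :=
  ∃ m : ι, Relation.ReflTransGen (systemDigraph A B).Adj (Sum.inr m) (Sum.inl v)

/-- The output matrix `C` of a target set `S`: the rows of the identity matrix indexed by `S`. -/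
def outputMatrix (S : Finset V) : Matrix S V ℝ :=
  (1 : Matrix V V ℝ).submatrix Subtype.val id

/-- The block matrix `[CB, CAB, …, CA^{N-1}B]`, where `N` is the number of nodes. -/
def outputControllabilityMatrix (A : Matrix V V ℝ) (B : Matrix V ι ℝ) (S : Finset V) :
    Matrix S (Fin (Fintype.card V) × ι) ℝ :=
  Matrix.of fun i p => (outputMatrix S * A ^ (p.1 : ℕ) * B) i p.2

/-- `(A, B, C)` is target controllable: `rank [CB, CAB, …, CA^{N-1}B] = |S|`. -/
def TargetControllable (A : Matrix V V ℝ) (B : Matrix V ι ℝ) (S : Finset V) : Prop :=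
  (outputControllabilityMatrix A B S).rank = S.card

/-- Two matrices have the same structure: their zero entries are at the same places. -/
def SameStructure {α β : Type*} (X Y : Matrix α β ℝ) : Prop :=
  ∀ i j, X i j = 0 ↔ Y i j = 0

/-- `S` is structurally (target) controllable for `(A, B, C)`: some system `(A', B', C)`, with `A'`
and `B'` of the same structure as `A` and `B`, is target controllable. -/
def StructurallyTargetControllable (A : Matrix V V ℝ) (B : Matrix V ι ℝ) (S : Finset V) : Prop :=
  ∃ (A' : Matrix V V ℝ) (B' : Matrix V ι ℝ),
    SameStructure A A' ∧ SameStructure B B' ∧ TargetControllable A' B' S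

end Systems

/-! ### Path covers -/

section Covers

variable {V : Type*} [DecidableEq V]

/-- A simple directed path, as the list of its (at least one) nodes. -/
def IsSimplePath (D : Digraph V) (p : List V) : Prop :=
  p ≠ [] ∧ p.Nodup ∧ p.IsChain D.Adj

/-- A simple directed circle `v₁ v₂ … v_c v₁`, as the list `[v₁, …, v_c]` with `c ≥ 1`. -/
def IsSimpleCircle (D : Digraph V) (c : List V) : Prop :=
  c ≠ [] ∧ c.Nodup ∧ (c ++ c.take 1).IsChain D.Adj

/-- The set of nodes on the members of a set of paths or circles. -/
def cover (Q : Finset (List V)) : Finset V :=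
  Q.biUnion List.toFinset

/-- `P` is a set of simple paths and `C` a set of simple circles of `D`, and each node occurs at
most once in `P ∪ C`, in the form `|Cover (P ∪ C)| = ∑ p_k + ∑ c_k`. -/
structure IsPathCircleSystem (D : Digraph V) (P C : Finset (List V)) : Prop where
  path : ∀ p ∈ P, IsSimplePath D p
  circle : ∀ c ∈ C, IsSimpleCircle D c
  disjoint : (cover (P ∪ C)).card = ∑ p ∈ P, p.length + ∑ c ∈ C, c.length

/-- The control sources of `B` are attached to `P ∪ C`: the first node of each path of `P` is
connected to a control source of its own, different for different paths, and every circle of `C`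
is accessible. A source may be connected to further nodes as well. -/
structure ControlSourcesAttached [Fintype V] {ι : Type*} [Fintype ι] (A : Matrix V V ℝ)
    (B : Matrix V ι ℝ) (P C : Finset (List V)) : Prop where
  paths : ∃ σ : P → ι, Function.Injective σ ∧
    ∀ p : P, ∀ v ∈ (p : List V).head?, B v (σ p) ≠ 0
  circles : ∀ c ∈ C, ∀ v ∈ c, Accessible A B v

end Covers

/-! ### Capacity networks with lower and upper bounds -/

/-- A directed graph with lower and upper bounds (the latter possibly infinite) on its arcs. The
values of the bounds at pairs that are not arcs are irrelevant. -/
structure CapacityNetwork (W : Type*) where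
  Arc : W → W → Prop
  lower : W → W → ℝ
  upper : W → W → EReal

open Classical in
/-- A feasible circulation: conservation at every vertex, and `l(e) ≤ f(e) ≤ c(e)` on every arc.
The values of `f` at pairs that are not arcs are irrelevant. -/
structure IsFeasibleCirculation {W : Type*} [Fintype W] (N : CapacityNetwork W)
    (f : W → W → ℝ) : Prop where
  conservation : ∀ a : W,
    (∑ b with N.Arc a b, f a b) - (∑ b with N.Arc b a, f b a) = 0
  lower_le : ∀ a b, N.Arc a b → N.lower a b ≤ f a b
  le_upper : ∀ a b, N.Arc a b → (f a b : EReal) ≤ N.upper a b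

/-- The vertices of the node-split network: the source `v_s`, the sink `v_t`, and `v^in`, `v^out`
for every node `v`. -/
inductive SplitNode (V : Type*) where
  | source : SplitNode V
  | sink : SplitNode V
  | nodeIn : V → SplitNode V
  | nodeOut : V → SplitNode V
  deriving DecidableEq, Fintype

section Split

open SplitNode

variable {V : Type*} [DecidableEq V]

/-- The arcs of the node-split network: `v_t → v_s`, and for all nodes `v_s → v^in`,
`v^out → v_t`, `v^in → v^out`, and `u^out → v^in` for each arc `u → v` of `D`. -/
def splitArc (D : Digraph V) : SplitNode V → SplitNode V → Prop
  | sink, source => True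
  | source, nodeIn _ => True
  | nodeOut _, sink => True
  | nodeIn u, nodeOut v => u = v
  | nodeOut u, nodeIn v => D.Adj u v
  | _, _ => False

/-- The lower bounds: `1` on `v^in → v^out` for target nodes `v`, and `0` on all other arcs. -/
def splitLower (S : Finset V) : SplitNode V → SplitNode V → ℝ
  | nodeIn v, nodeOut _ => if v ∈ S then 1 else 0
  | _, _ => 0

/-- The upper bounds: `∞` on `v_t → v_s`, and `1` on all other arcs. -/
def splitUpper : SplitNode V → SplitNode V → EReal
  | sink, source => ⊤
  | _, _ => 1

/-- The node-split network `D'` of the digraph `D` with target set `S`. -/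
def splitNetwork (D : Digraph V) (S : Finset V) : CapacityNetwork (SplitNode V) where
  Arc := splitArc D
  lower := splitLower S
  upper := splitUpper

/-- The number of times each arc of the node-split network is traversed when each path
`v₁ … v_p` of `P` is turned into the closed walk
`v_s v₁^in v₁^out v₂^in … v_p^out v_t v_s` and each circle `v₁ … v_c v₁` of `C` into
`v₁^in v₁^out v₂^in … v_c^out v₁^in`. -/
def inducedFlow (P C : Finset (List V)) : SplitNode V → SplitNode V → ℕ
  | sink, source => P.card
  | source, nodeIn v => (P.filter fun p => p.head? = some v).card
  | nodeOut v, sink => (P.filter fun p => p.getLast? = some v).card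
  | nodeIn v, nodeOut _ => (P.filter fun p => v ∈ p).card + (C.filter fun c => v ∈ c).card
  | nodeOut u, nodeIn v => (P.filter fun p => [u, v] <:+: p).card +
      (C.filter fun c => [u, v] <:+: c ++ c.take 1).card
  | _, _ => 0

end Split

end TargetControl

end

/-!
The circulation is first rounded, then decomposed into paths and circles, and finally the resulting
path cover is shown to be controllable.

*Rounding* (`exists_integral_circulation`). In a real circulation, no vertex is incident with
exactly one arc of fractional value. Hence there are at least as many such arcs as vertices incident
with them, so that, the conservation laws being dependent, a nonzero circulation lives on these
arcs. A suitable multiple of it makes one more value integral without crossing an integer.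

*Decomposition* (`exists_isDecomposition_of_circulation`). Since the node capacities are `1`, the
arcs `u^out → v^in` with flow form a relation on the nodes with flow in which successors and
predecessors are unique. Such a relation decomposes into paths and circles, whose induced flow is
the given one.

*Controllability* (`IsDecomposition.exists_subsystem`). The rows of `[B, AB, …, A^{N-1}B]` indexed
by a set of nodes are linearly independent exactly when the generating functions `∑ₖ Aᵏ B Xᵏ` of
these nodes are, by Cayley–Hamilton. Independence is an open condition, so it suffices to find a
system that uses some of the given connections and in which the covered nodes are independent. It is
built step by step. On the paths, every node responds with a power of `X` to the source of its own
path. Then, as long as a covered node is missing, accessibility provides an arc from the nodes or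
sources at hand to a new node. An uncovered new node is added alone, while a new node on a circle
brings in its circle of length `n`, whose nodes then have the responses `Xⁱ H / (1 - c Xⁿ)` with
`i < n`. For all but finitely many `c` the denominator is coprime to the numerator of `H`, and the
nodes of the circle take part in no linear relation (`IsIndependentSubsystem.extend`).
-/

namespace TargetControl

/-! ### Rounding circulations -/

section Rounding

variable {W : Type*} [Fintype W]

/-- If every vertex met by the arc set `F` has at least two incidences with `F` (a loop counts
twice), then some nonzero real circulation is supported on `F`: there are at least as many arcs as
vertices, and the conservation laws at these vertices are linearly dependent. -/
theorem exists_circulation_supported_on [DecidableEq W] (F : Finset (W × W)) (hF : F.Nonempty)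
    (hdeg : ∀ a, (∃ e ∈ F, e.1 = a ∨ e.2 = a) →
      2 ≤ (F.filter fun e => e.1 = a).card + (F.filter fun e => e.2 = a).card) :
    ∃ d : W → W → ℝ, (∃ a b, d a b ≠ 0) ∧ (∀ a b, (a, b) ∉ F → d a b = 0) ∧
      ∀ a, ∑ b, d a b = ∑ b, d b a := by
  set T : Finset W := F.image Prod.fst ∪ F.image Prod.snd with hT
  have memT : ∀ a, a ∈ T ↔ ∃ e ∈ F, e.1 = a ∨ e.2 = a := by
    intro a
    simp only [hT, Finset.mem_union, Finset.mem_image]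
    constructor
    · rintro (⟨e, he, h⟩ | ⟨e, he, h⟩)
      · exact ⟨e, he, Or.inl h⟩
      · exact ⟨e, he, Or.inr h⟩
    · rintro ⟨e, he, h | h⟩
      · exact Or.inl ⟨e, he, h⟩
      · exact Or.inr ⟨e, he, h⟩
  have hcard : T.card ≤ F.card := by
    have h1 : F.card = ∑ a ∈ T, (F.filter fun e => e.1 = a).card :=
      Finset.card_eq_sum_card_fiberwise fun e he => (memT _).2 ⟨e, he, Or.inl rfl⟩
    have h2 : F.card = ∑ a ∈ T, (F.filter fun e => e.2 = a).card :=
      Finset.card_eq_sum_card_fiberwise fun e he => (memT _).2 ⟨e, he, Or.inr rfl⟩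
    have h3 : ∑ a ∈ T, 2 ≤ ∑ a ∈ T,
        ((F.filter fun e => e.1 = a).card + (F.filter fun e => e.2 = a).card) :=
      Finset.sum_le_sum fun a ha => hdeg a ((memT a).1 ha)
    rw [Finset.sum_add_distrib, ← h1, ← h2, Finset.sum_const, smul_eq_mul] at h3
    omega
  obtain ⟨e₀, he₀⟩ := hF
  have ha₀ : e₀.1 ∈ T := (memT _).2 ⟨e₀, he₀, Or.inl rfl⟩
  -- The conservation law at one vertex follows from the others, so that there are more unknowns
  -- than equations.
  let I : Matrix (T.erase e₀.1) F ℝ := fun a e =>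
    (if e.1.1 = a.1 then 1 else 0) - (if e.1.2 = a.1 then 1 else 0)
  have hker : LinearMap.ker I.mulVecLin ≠ ⊥ := by
    apply LinearMap.ker_ne_bot_of_finrank_lt
    simp only [Module.finrank_fintype_fun_eq_card, Fintype.card_coe, Finset.card_erase_of_mem ha₀]
    have := Finset.card_pos.2 ⟨_, ha₀⟩
    omega
  obtain ⟨x, hx, hx0⟩ := Submodule.exists_mem_ne_zero_of_ne_bot hker
  let d : W → W → ℝ := fun a b => if h : (a, b) ∈ F then x ⟨(a, b), h⟩ else 0
  have hsum : ∀ φ : W × W → ℝ, ∑ e : F, φ e.1 * x e = ∑ a, ∑ b, φ (a, b) * d a b := by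
    intro φ
    rw [← Fintype.sum_prod_type' (fun a b => φ (a, b) * d a b)]
    rw [← Finset.sum_subset (Finset.subset_univ F), ← Finset.sum_coe_sort F]
    · refine Finset.sum_congr rfl fun e _ => ?_
      simp [d]
    · intro e _ he
      simp [d, he]
  have hout : ∀ a, ∑ e : F, (if e.1.1 = a then 1 else 0) * x e = ∑ b, d a b := by
    intro a
    rw [hsum fun e => if e.1 = a then 1 else 0, Finset.sum_eq_single a] <;> simp +contextual
  have hin : ∀ a, ∑ e : F, (if e.1.2 = a then 1 else 0) * x e = ∑ b, d b a := by
    intro a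
    rw [hsum fun e => if e.2 = a then 1 else 0]
    simp
  have hne : ∀ a, a ≠ e₀.1 → ∑ b, d a b = ∑ b, d b a := by
    intro a ha
    by_cases haT : a ∈ T
    · have h : ∑ e : F, ((if e.1.1 = a then (1 : ℝ) else 0) -
          (if e.1.2 = a then 1 else 0)) * x e = 0 :=
        congrFun (LinearMap.mem_ker.1 hx) ⟨a, Finset.mem_erase.2 ⟨ha, haT⟩⟩
      simp only [sub_mul, Finset.sum_sub_distrib] at h
      rw [hout, hin] at h
      linarith
    · rw [Finset.sum_eq_zero, Finset.sum_eq_zero]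
      · intro b _
        exact dif_neg fun h => haT ((memT a).2 ⟨_, h, Or.inr rfl⟩)
      · intro b _
        exact dif_neg fun h => haT ((memT a).2 ⟨_, h, Or.inl rfl⟩)
  refine ⟨d, ?_, fun a b h => dif_neg h, fun a => ?_⟩
  · obtain ⟨e, he⟩ := Function.ne_iff.1 hx0
    exact ⟨e.1.1, e.1.2, by simpa [d] using he⟩
  · by_cases ha : a = e₀.1
    · have htot : ∑ a, (∑ b, d a b - ∑ b, d b a) = 0 := by
        rw [Finset.sum_sub_distrib, Finset.sum_comm, sub_self]
      rw [Finset.sum_eq_single a (fun b _ hb => sub_eq_zero.2 (hne b (ha ▸ hb))) (by simp)] at htot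
      linarith
    · exact hne a ha

/-- No vertex of a circulation is incident with exactly one arc of fractional value. -/
theorem two_le_card_fract_ne_zero [DecidableEq W] (f : W → W → ℝ) (a : W)
    (hf : ∑ b, f a b = ∑ b, f b a)
    (F : Finset (W × W)) (hF : ∀ e, e ∈ F ↔ Int.fract (f e.1 e.2) ≠ 0)
    (ha : ∃ e ∈ F, e.1 = a ∨ e.2 = a) :
    2 ≤ (F.filter fun e => e.1 = a).card + (F.filter fun e => e.2 = a).card := by
  have hout : (F.filter fun e => e.1 = a).card =
      (Finset.univ.filter fun b => Int.fract (f a b) ≠ 0).card := by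
    refine (Finset.card_bij (fun b _ => (a, b)) ?_ ?_ ?_).symm
    · intro b hb; simpa [hF] using hb
    · intro b _ c _ h; exact (Prod.ext_iff.1 h).2
    · rintro ⟨x, b⟩ h
      obtain ⟨h1, rfl⟩ := Finset.mem_filter.1 h
      exact ⟨b, by simpa [hF] using h1, rfl⟩
  have hin : (F.filter fun e => e.2 = a).card =
      (Finset.univ.filter fun b => Int.fract (f b a) ≠ 0).card := by
    refine (Finset.card_bij (fun b _ => (b, a)) ?_ ?_ ?_).symm
    · intro b hb; simpa [hF] using hb
    · intro b _ c _ h; exact (Prod.ext_iff.1 h).1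
    · rintro ⟨b, x⟩ h
      obtain ⟨h1, rfl⟩ := Finset.mem_filter.1 h
      exact ⟨b, by simpa [hF] using h1, rfl⟩
  have hint : ∀ g : W → ℝ, (Finset.univ.filter fun b => Int.fract (g b) ≠ 0).card = 0 →
      ∃ z : ℤ, ∑ b, g b = z := by
    intro g hg
    refine ⟨∑ b, ⌊g b⌋, ?_⟩
    push_cast
    refine Finset.sum_congr rfl fun b _ => ?_
    have h : Int.fract (g b) = 0 := by
      by_contra h
      exact Finset.notMem_empty b ((Finset.card_eq_zero.1 hg) ▸ by simpa using h)
    rw [Int.fract] at h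
    linarith
  -- A sum with exactly one fractional term is not an integer.
  have hfrac : ∀ g : W → ℝ, (Finset.univ.filter fun b => Int.fract (g b) ≠ 0).card = 1 →
      ∀ z : ℤ, ∑ b, g b ≠ z := by
    intro g hg z hz
    obtain ⟨c, hc⟩ := Finset.card_eq_one.1 hg
    have hc0 : Int.fract (g c) ≠ 0 := by
      have : c ∈ Finset.univ.filter fun b => Int.fract (g b) ≠ 0 := by rw [hc]; simp
      simpa using this
    have h : ∑ b, Int.fract (g b) = Int.fract (g c) := by
      refine Finset.sum_eq_single c (fun b _ hb => ?_) (by simp)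
      by_contra h
      have : b ∈ Finset.univ.filter fun b => Int.fract (g b) ≠ 0 := by simpa using h
      rw [hc] at this
      exact hb (Finset.mem_singleton.1 this)
    have h2 : Int.fract (g c) = ((z - ∑ b, ⌊g b⌋ : ℤ) : ℝ) := by
      push_cast
      rw [← h, ← hz, ← Finset.sum_sub_distrib]
      rfl
    apply hc0
    rw [← Int.fract_fract, h2, Int.fract_intCast]
  rw [hout, hin]
  by_contra! hlt
  obtain ⟨e, he, hea⟩ := ha
  have hpos : 1 ≤ (Finset.univ.filter fun b => Int.fract (f a b) ≠ 0).card +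
      (Finset.univ.filter fun b => Int.fract (f b a) ≠ 0).card := by
    rw [← hout, ← hin]
    rcases hea with h | h
    · have : 0 < (F.filter fun e => e.1 = a).card :=
        Finset.card_pos.2 ⟨e, Finset.mem_filter.2 ⟨he, h⟩⟩
      omega
    · have : 0 < (F.filter fun e => e.2 = a).card :=
        Finset.card_pos.2 ⟨e, Finset.mem_filter.2 ⟨he, h⟩⟩
      omega
  obtain ⟨h1, h2⟩ | ⟨h1, h2⟩ : ((Finset.univ.filter fun b => Int.fract (f a b) ≠ 0).card = 1 ∧
      (Finset.univ.filter fun b => Int.fract (f b a) ≠ 0).card = 0) ∨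
      ((Finset.univ.filter fun b => Int.fract (f a b) ≠ 0).card = 0 ∧
      (Finset.univ.filter fun b => Int.fract (f b a) ≠ 0).card = 1) := by omega
  · obtain ⟨z, hz⟩ := hint _ h2
    exact hfrac _ h1 z (hf.trans hz)
  · obtain ⟨z, hz⟩ := hint _ h1
    exact hfrac _ h2 z (hf ▸ hz)

/-- Moving from `f` in the direction `d` until the first coordinate reaches an integer stays between
the roundings of `f`. -/
theorem exists_step_to_integer {E : Type*} (F : Finset E) (f d : E → ℝ)
    (hd : ∃ e, d e ≠ 0) (hdF : ∀ e, e ∉ F → d e = 0) :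
    ∃ t : ℝ, (∀ e, (⌊f e⌋ : ℝ) ≤ f e + t * d e ∧ f e + t * d e ≤ ⌈f e⌉) ∧
      ∃ e ∈ F, Int.fract (f e + t * d e) = 0 := by
  classical
  -- the step at which the value at `e` reaches the next integer
  let s : E → ℝ := fun e => ((if 0 < d e then (⌈f e⌉ : ℝ) else ⌊f e⌋) - f e) / d e
  obtain ⟨e₁, he₁⟩ := hd
  have hne : (F.filter fun e => d e ≠ 0).Nonempty :=
    ⟨e₁, Finset.mem_filter.2 ⟨by by_contra h; exact he₁ (hdF _ h), he₁⟩⟩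
  obtain ⟨e₀, he₀, hmin⟩ := Finset.exists_min_image _ s hne
  obtain ⟨he₀F, hd₀⟩ := Finset.mem_filter.1 he₀
  have hs : ∀ e, d e ≠ 0 → 0 ≤ s e := by
    intro e he
    simp only [s]
    split_ifs with h
    · exact div_nonneg (sub_nonneg.2 (Int.le_ceil _)) h.le
    · exact div_nonneg_of_nonpos (sub_nonpos.2 (Int.floor_le _)) (not_lt.1 h)
  refine ⟨s e₀, fun e => ?_, e₀, he₀F, ?_⟩
  · by_cases he : d e = 0
    · simp only [he, mul_zero, add_zero]
      exact ⟨Int.floor_le _, Int.le_ceil _⟩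
    · have h0 := hs e₀ hd₀
      have h1 : s e₀ ≤ s e :=
        hmin e (Finset.mem_filter.2 ⟨by by_contra h; exact he (hdF _ h), he⟩)
      have h2 : s e * d e = (if 0 < d e then (⌈f e⌉ : ℝ) else ⌊f e⌋) - f e :=
        div_mul_cancel₀ _ he
      split_ifs at h2 with h
      · have := mul_le_mul_of_nonneg_right h1 h.le
        have := mul_nonneg h0 h.le
        exact ⟨by linarith [Int.floor_le (f e)], by linarith⟩
      · have := mul_le_mul_of_nonpos_right h1 (not_lt.1 h)
        have := mul_nonpos_of_nonneg_of_nonpos h0 (not_lt.1 h)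
        exact ⟨by linarith, by linarith [Int.le_ceil (f e)]⟩
  · have h2 : s e₀ * d e₀ = (if 0 < d e₀ then (⌈f e₀⌉ : ℝ) else ⌊f e₀⌋) - f e₀ :=
      div_mul_cancel₀ _ hd₀
    rw [h2, add_sub_cancel]
    split_ifs <;> exact Int.fract_intCast _

/-- A real circulation can be rounded to an integral one, each value being rounded up or down. As
long as fractional values remain, a circulation supported on their arcs is added that makes one more
value integral. -/
theorem exists_integral_circulation (f : W → W → ℝ) (hf : ∀ a, ∑ b, f a b = ∑ b, f b a) :
    ∃ g : W → W → ℤ, (∀ a, ∑ b, g a b = ∑ b, g b a) ∧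
      ∀ a b, ⌊f a b⌋ ≤ g a b ∧ g a b ≤ ⌈f a b⌉ := by
  classical
  obtain ⟨n, hn⟩ : ∃ n, (Finset.univ.filter fun e : W × W => Int.fract (f e.1 e.2) ≠ 0).card = n :=
    ⟨_, rfl⟩
  induction n using Nat.strong_induction_on generalizing f with
  | _ n ih =>
  set F := Finset.univ.filter fun e : W × W => Int.fract (f e.1 e.2) ≠ 0 with hFdef
  have hF : ∀ e, e ∈ F ↔ Int.fract (f e.1 e.2) ≠ 0 := by simp [hFdef]
  rcases F.eq_empty_or_nonempty with h0 | hne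
  · have hfl : ∀ a b, (⌊f a b⌋ : ℝ) = f a b := by
      intro a b
      have h : Int.fract (f a b) = 0 := by
        by_contra h
        exact Finset.notMem_empty (a, b) (h0 ▸ (hF (a, b)).2 h)
      rw [Int.fract] at h
      linarith
    refine ⟨fun a b => ⌊f a b⌋, fun a => ?_, fun a b => ⟨le_rfl, Int.floor_le_ceil _⟩⟩
    have h : ∑ b, (⌊f a b⌋ : ℝ) = ∑ b, (⌊f b a⌋ : ℝ) := by
      rw [Finset.sum_congr rfl fun b _ => hfl a b, Finset.sum_congr rfl fun b _ => hfl b a, hf a]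
    exact_mod_cast h
  · obtain ⟨d, ⟨a₀, b₀, hd0⟩, hdF, hd⟩ := exists_circulation_supported_on F hne fun a ha =>
      two_le_card_fract_ne_zero f a (hf a) F hF ha
    obtain ⟨t, ht, e₁, he₁, hfr⟩ := exists_step_to_integer F (fun e => f e.1 e.2)
      (fun e => d e.1 e.2) ⟨(a₀, b₀), hd0⟩ fun e he => hdF _ _ he
    let f' : W → W → ℝ := fun a b => f a b + t * d a b
    have hf' : ∀ a, ∑ b, f' a b = ∑ b, f' b a := by
      intro a
      simp only [f', Finset.sum_add_distrib, ← Finset.mul_sum, hf a, hd a]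
    have hlt : (Finset.univ.filter fun e : W × W => Int.fract (f' e.1 e.2) ≠ 0).card < n := by
      rw [← hn]
      refine Finset.card_lt_card (Finset.ssubset_iff_of_subset ?_ |>.2 ⟨e₁, he₁, ?_⟩)
      · intro e he
        by_contra h
        refine (Finset.mem_filter.1 he).2 ?_
        simp only [f', hdF _ _ h, mul_zero, add_zero]
        simpa [hF] using h
      · simpa [f'] using hfr
    obtain ⟨g, hg, hgf⟩ := ih _ hlt f' hf' rfl
    refine ⟨g, hg, fun a b => ⟨?_, ?_⟩⟩
    · exact (Int.le_floor.2 (ht (a, b)).1).trans (hgf a b).1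
    · exact (hgf a b).2.trans (Int.ceil_le.2 (ht (a, b)).2)

end Rounding

/-! ### Consecutive entries of lists and circles -/

section Lists

variable {α : Type*}

theorem pair_infix_append {a b : α} {l₁ l₂ : List α} : [a, b] <:+: l₁ ++ l₂ ↔
    [a, b] <:+: l₁ ∨ [a, b] <:+: l₂ ∨ (l₁.getLast? = some a ∧ l₂.head? = some b) := by
  constructor
  · rintro ⟨s, t, h⟩
    rw [List.append_assoc, List.append_eq_append_iff] at h
    rcases h with ⟨m, h1, h2⟩ | ⟨m, h1, h2⟩
    · match m, h1, h2 with
      | [], h1, h2 => exact Or.inr (Or.inl ⟨[], t, by simpa using h2⟩)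
      | [x], h1, h2 =>
        simp only [List.cons_append, List.nil_append, List.cons.injEq] at h2
        obtain ⟨rfl, h2⟩ := h2
        exact Or.inr (Or.inr ⟨by simp [h1], by simp [← h2]⟩)
      | x :: y :: m, h1, h2 =>
        simp only [List.cons_append, List.nil_append, List.cons.injEq] at h2
        obtain ⟨rfl, rfl, h2⟩ := h2
        exact Or.inl ⟨s, m, by simp [h1]⟩
    · exact Or.inr (Or.inl ⟨m, t, by simp [h2]⟩)
  · rintro (h | h | ⟨h1, h2⟩)
    · exact h.trans (List.infix_append' [] l₁ l₂)
    · exact h.trans (List.suffix_append l₁ l₂).isInfix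
    · obtain ⟨s, rfl⟩ := List.getLast?_eq_some_iff.1 h1
      obtain ⟨t, rfl⟩ := List.head?_eq_some_iff.1 h2
      exact ⟨s, t, by simp⟩

theorem head_or_exists_pair_infix {v : α} {l : List α} (h : v ∈ l) :
    l.head? = some v ∨ ∃ u, [u, v] <:+: l := by
  obtain ⟨s, t, rfl⟩ := List.append_of_mem h
  rcases s.eq_nil_or_concat with rfl | ⟨s, u, rfl⟩
  · simp
  · exact Or.inr ⟨u, s, t, by simp⟩

theorem getLast_or_exists_pair_infix {v : α} {l : List α} (h : v ∈ l) :
    l.getLast? = some v ∨ ∃ w, [v, w] <:+: l := by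
  obtain ⟨s, t, rfl⟩ := List.append_of_mem h
  rcases t with - | ⟨w, t⟩
  · simp
  · exact Or.inr ⟨w, s, t, by simp⟩

theorem head_ne_of_pair_infix {u v : α} {l : List α} (hl : l.Nodup) (h : [u, v] <:+: l) :
    l.head? ≠ some v := by
  obtain ⟨s, t, rfl⟩ := h
  intro hv
  rcases s with - | ⟨x, s⟩
  · simp_all
  · simp only [List.cons_append, List.head?_cons, Option.some.injEq] at hv
    simp_all

theorem getLast_ne_of_pair_infix {u v : α} {l : List α} (hl : l.Nodup) (h : [u, v] <:+: l) :
    l.getLast? ≠ some u := by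
  obtain ⟨s, t, rfl⟩ := h
  intro hv
  rcases t.eq_nil_or_concat with rfl | ⟨t, x, rfl⟩
  · obtain rfl : v = u := by simpa using hv
    simp [List.nodup_append] at hl
  · rw [List.concat_eq_append, ← List.append_assoc, List.getLast?_concat, Option.some.injEq] at hv
    subst hv
    simp [List.nodup_append] at hl

/-- The consecutive pairs of the circle on `l` are those of the list `l` and the closing pair that
leads from the last entry to the first. -/
theorem pair_infix_circle_of_nonempty {l : List α} (hl : l ≠ []) :
    ∃ x y, l.getLast? = some x ∧ l.head? = some y ∧ ∀ a b, [a, b] <:+: l ++ l.take 1 ↔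
      [a, b] <:+: l ∨ (a = x ∧ b = y) := by
  obtain ⟨y, t, rfl⟩ := List.exists_cons_of_ne_nil hl
  refine ⟨_, y, List.getLast?_eq_some_getLast hl, rfl, fun a b => ?_⟩
  have : ¬ [a, b] <:+: [y] := fun h => by simpa using h.length_le
  rw [List.take_succ_cons, List.take_zero, pair_infix_append, List.getLast?_eq_some_getLast hl]
  simp only [this, false_or, List.head?_cons, Option.some.injEq]
  exact or_congr_right ⟨fun h => ⟨h.1.symm, h.2.symm⟩, fun h => ⟨h.1.symm, h.2.symm⟩⟩

theorem mem_of_pair_infix_circle {u v : α} {c : List α} (h : [u, v] <:+: c ++ c.take 1) :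
    u ∈ c ∧ v ∈ c := by
  have h1 := h.subset
  have h2 : ∀ x ∈ c ++ c.take 1, x ∈ c := fun x hx =>
    (List.mem_append.1 hx).elim id List.mem_of_mem_take
  exact ⟨h2 _ (h1 (by simp)), h2 _ (h1 (by simp))⟩

theorem exists_pair_infix_circle {v : α} {c : List α} (h : v ∈ c) :
    (∃ u, [u, v] <:+: c ++ c.take 1) ∧ ∃ w, [v, w] <:+: c ++ c.take 1 := by
  obtain ⟨x, y, hx, hy, hxy⟩ := pair_infix_circle_of_nonempty (List.ne_nil_of_mem h)
  simp only [hxy]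
  constructor
  · rcases head_or_exists_pair_infix h with h | ⟨u, h⟩
    · exact ⟨x, Or.inr ⟨rfl, Option.some.inj (h.symm.trans hy)⟩⟩
    · exact ⟨u, Or.inl h⟩
  · rcases getLast_or_exists_pair_infix h with h | ⟨u, h⟩
    · exact ⟨y, Or.inr ⟨Option.some.inj (h.symm.trans hx), rfl⟩⟩
    · exact ⟨u, Or.inl h⟩

theorem pair_infix_getElem_iff {l : List α} (hl : l.Nodup) {i : ℕ}
    (hi : i + 1 < l.length) (u : α) : [u, l[i + 1]] <:+: l ↔ u = l[i] := by
  constructor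
  · rintro ⟨s, t, h⟩
    have h1 : l[s.length + 1]? = some l[i + 1] := by
      conv_lhs => rw [← h]
      simp
    have h2 : l[s.length]? = some u := by
      rw [← h]
      simp
    obtain ⟨h3, h4⟩ := List.getElem?_eq_some_iff.1 h1
    obtain rfl : s.length = i := Nat.succ_injective (hl.getElem_inj_iff.1 h4)
    obtain ⟨_, h5⟩ := List.getElem?_eq_some_iff.1 h2
    exact h5.symm
  · rintro rfl
    exact ⟨l.take i, l.drop (i + 2), by simp⟩

end Lists

/-! ### Decomposition of a partial injection into paths and circles -/

section Decomposition

variable {V : Type*} [DecidableEq V]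

/-- `P` and `C` decompose the relation `E` on the node set `U` into paths and circles: every node of
`U` is on exactly one member of `P ∪ C`, members have no repeated nodes, and `E` consists exactly of
the consecutive pairs of the paths (as lists) and of the circles (closed up by their first node). -/
structure IsDecomposition (U : Finset V) (E : Finset (V × V)) (P C : Finset (List V)) : Prop where
  ne_nil : ∀ l ∈ P ∪ C, l ≠ []
  nodup : ∀ l ∈ P ∪ C, l.Nodup
  mem_iff : ∀ v, v ∈ U ↔ ∃ l ∈ P ∪ C, v ∈ l
  eq_of_mem : ∀ l ∈ P ∪ C, ∀ l' ∈ P ∪ C, ∀ v ∈ l, v ∈ l' → l = l'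
  disjoint : Disjoint P C
  edge_iff : ∀ u v, (u, v) ∈ E ↔
    (∃ p ∈ P, [u, v] <:+: p) ∨ ∃ c ∈ C, [u, v] <:+: c ++ c.take 1

namespace IsDecomposition

variable {U : Finset V} {E : Finset (V × V)} {P C : Finset (List V)}

/-- The first nodes of the paths are the nodes without predecessor. -/
theorem exists_head_iff (h : IsDecomposition U E P C) (v : V) :
    (∃ p ∈ P, p.head? = some v) ↔ v ∈ U ∧ ∀ u, (u, v) ∉ E := by
  constructor
  · rintro ⟨p, hp, hv⟩
    have hpP : p ∈ P ∪ C := Finset.mem_union_left _ hp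
    have hvp : v ∈ p := List.mem_of_mem_head? hv
    refine ⟨(h.mem_iff v).2 ⟨p, hpP, hvp⟩, fun u huv => ?_⟩
    rcases (h.edge_iff u v).1 huv with ⟨q, hq, hi⟩ | ⟨c, hc, hi⟩
    · obtain rfl := h.eq_of_mem p hpP q (Finset.mem_union_left _ hq) v hvp
        (hi.subset (by simp))
      exact head_ne_of_pair_infix (h.nodup p hpP) hi hv
    · obtain rfl := h.eq_of_mem p hpP c (Finset.mem_union_right _ hc) v hvp
        (mem_of_pair_infix_circle hi).2
      exact Finset.disjoint_left.1 h.disjoint hp hc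
  · rintro ⟨hv, hE⟩
    obtain ⟨l, hl, hvl⟩ := (h.mem_iff v).1 hv
    rcases Finset.mem_union.1 hl with hl | hl
    · rcases head_or_exists_pair_infix hvl with hh | ⟨u, hu⟩
      · exact ⟨l, hl, hh⟩
      · exact absurd ((h.edge_iff u v).2 (Or.inl ⟨l, hl, hu⟩)) (hE u)
    · obtain ⟨u, hu⟩ := (exists_pair_infix_circle hvl).1
      exact absurd ((h.edge_iff u v).2 (Or.inr ⟨l, hl, hu⟩)) (hE u)

/-- The last nodes of the paths are the nodes without successor. -/
theorem exists_getLast_iff (h : IsDecomposition U E P C) (u : V) :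
    (∃ p ∈ P, p.getLast? = some u) ↔ u ∈ U ∧ ∀ v, (u, v) ∉ E := by
  constructor
  · rintro ⟨p, hp, hu⟩
    have hpP : p ∈ P ∪ C := Finset.mem_union_left _ hp
    have hup : u ∈ p := List.mem_of_getLast? hu
    refine ⟨(h.mem_iff u).2 ⟨p, hpP, hup⟩, fun v huv => ?_⟩
    rcases (h.edge_iff u v).1 huv with ⟨q, hq, hi⟩ | ⟨c, hc, hi⟩
    · obtain rfl := h.eq_of_mem p hpP q (Finset.mem_union_left _ hq) u hup
        (hi.subset (by simp))
      exact getLast_ne_of_pair_infix (h.nodup p hpP) hi hu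
    · obtain rfl := h.eq_of_mem p hpP c (Finset.mem_union_right _ hc) u hup
        (mem_of_pair_infix_circle hi).1
      exact Finset.disjoint_left.1 h.disjoint hp hc
  · rintro ⟨hu, hE⟩
    obtain ⟨l, hl, hul⟩ := (h.mem_iff u).1 hu
    rcases Finset.mem_union.1 hl with hl | hl
    · rcases getLast_or_exists_pair_infix hul with hh | ⟨v, hv⟩
      · exact ⟨l, hl, hh⟩
      · exact absurd ((h.edge_iff u v).2 (Or.inl ⟨l, hl, hv⟩)) (hE v)
    · obtain ⟨v, hv⟩ := (exists_pair_infix_circle hul).2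
      exact absurd ((h.edge_iff u v).2 (Or.inr ⟨l, hl, hv⟩)) (hE v)

/-- A new edge from the last to the first node of a path turns this path into a circle. -/
theorem close_path (h : IsDecomposition U E P C) {p : List V} (hp : p ∈ P) {u v : V}
    (hu : p.getLast? = some u) (hv : p.head? = some v) :
    IsDecomposition U (insert (u, v) E) (P.erase p) (insert p C) := by
  have hU : P.erase p ∪ insert p C = P ∪ C := by
    ext l
    simp only [Finset.mem_union, Finset.mem_erase, Finset.mem_insert]
    by_cases hl : l = p
    · simp [hl, hp]
    · simp [hl]
  refine ⟨hU ▸ h.ne_nil, hU ▸ h.nodup, hU ▸ h.mem_iff, hU ▸ h.eq_of_mem, ?_, fun a b => ?_⟩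
  · rw [Finset.disjoint_insert_right]
    exact ⟨by simp, h.disjoint.mono_left (Finset.erase_subset _ _)⟩
  · obtain ⟨x, y, hx, hy, hxy⟩ :=
      pair_infix_circle_of_nonempty (h.ne_nil p (Finset.mem_union_left _ hp))
    obtain rfl : u = x := Option.some.inj (hu.symm.trans hx)
    obtain rfl : v = y := Option.some.inj (hv.symm.trans hy)
    rw [Finset.mem_insert, h.edge_iff, Prod.mk.injEq]
    simp only [Finset.mem_erase, Finset.mem_insert, exists_eq_or_imp, hxy]
    constructor
    · rintro (hab | ⟨q, hq, hi⟩ | hc)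
      · exact Or.inr (Or.inl (Or.inr hab))
      · by_cases hqp : q = p
        · exact Or.inr (Or.inl (Or.inl (hqp ▸ hi)))
        · exact Or.inl ⟨q, ⟨hqp, hq⟩, hi⟩
      · exact Or.inr (Or.inr hc)
    · rintro (⟨q, hq, hi⟩ | (hi | hab) | hc)
      · exact Or.inr (Or.inl ⟨q, hq.2, hi⟩)
      · exact Or.inr (Or.inl ⟨p, hp, hi⟩)
      · exact Or.inl hab
      · exact Or.inr (Or.inr hc)

/-- A new edge from the last node of a path to the first node of another one joins the two paths. -/
theorem join_paths (h : IsDecomposition U E P C) {p q : List V} (hp : p ∈ P) (hq : q ∈ P)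
    (hpq : p ≠ q) {u v : V} (hu : p.getLast? = some u) (hv : q.head? = some v) :
    IsDecomposition U (insert (u, v) E) (insert (p ++ q) ((P.erase p).erase q)) C := by
  have hpP : p ∈ P ∪ C := Finset.mem_union_left _ hp
  have hqP : q ∈ P ∪ C := Finset.mem_union_left _ hq
  have hdisj : ∀ a ∈ p, a ∉ q := fun a ha ha' => hpq (h.eq_of_mem p hpP q hqP a ha ha')
  have hcases : ∀ l ∈ insert (p ++ q) ((P.erase p).erase q) ∪ C,
      l = p ++ q ∨ (l ∈ P ∪ C ∧ l ≠ p ∧ l ≠ q) := by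
    intro l hl
    rcases Finset.mem_union.1 hl with hl | hlC
    · rcases Finset.mem_insert.1 hl with hl | hl
      · exact Or.inl hl
      · simp only [Finset.mem_erase] at hl
        exact Or.inr ⟨Finset.mem_union_left _ hl.2.2, hl.2.1, hl.1⟩
    · refine Or.inr ⟨Finset.mem_union_right _ hlC, ?_, ?_⟩
      · rintro rfl; exact Finset.disjoint_left.1 h.disjoint hp hlC
      · rintro rfl; exact Finset.disjoint_left.1 h.disjoint hq hlC
  have hmem : ∀ l ∈ P ∪ C, l ≠ p → l ≠ q → l ∈ insert (p ++ q) ((P.erase p).erase q) ∪ C := by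
    intro l hl h1 h2
    simp only [Finset.mem_union, Finset.mem_insert, Finset.mem_erase] at hl ⊢
    tauto
  have hnew : p ++ q ∈ insert (p ++ q) ((P.erase p).erase q) ∪ C := by simp
  have hsep : ∀ l ∈ P ∪ C, l ≠ p → l ≠ q → ∀ a ∈ l, a ∉ p ++ q := by
    intro l hl h1 h2 a ha ha'
    rcases List.mem_append.1 ha' with ha' | ha'
    · exact h1 (h.eq_of_mem l hl p hpP a ha ha')
    · exact h2 (h.eq_of_mem l hl q hqP a ha ha')
  refine ⟨fun l hl => ?_, fun l hl => ?_, fun a => ?_, fun l hl l' hl' a ha ha' => ?_, ?_,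
    fun a b => ?_⟩
  · rcases hcases l hl with rfl | ⟨hl, -, -⟩
    · exact List.append_ne_nil_of_left_ne_nil (h.ne_nil p hpP) q
    · exact h.ne_nil l hl
  · rcases hcases l hl with rfl | ⟨hl, -, -⟩
    · exact List.Nodup.append (h.nodup p hpP) (h.nodup q hqP) fun a ha ha' => hdisj a ha ha'
    · exact h.nodup l hl
  · rw [h.mem_iff]
    constructor
    · rintro ⟨l, hl, ha⟩
      by_cases h1 : l = p
      · exact ⟨_, hnew, List.mem_append_left _ (h1 ▸ ha)⟩
      by_cases h2 : l = q
      · exact ⟨_, hnew, List.mem_append_right _ (h2 ▸ ha)⟩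
      exact ⟨l, hmem l hl h1 h2, ha⟩
    · rintro ⟨l, hl, ha⟩
      rcases hcases l hl with rfl | ⟨hl, -, -⟩
      · rcases List.mem_append.1 ha with ha | ha
        · exact ⟨p, hpP, ha⟩
        · exact ⟨q, hqP, ha⟩
      · exact ⟨l, hl, ha⟩
  · rcases hcases l hl with rfl | ⟨hl, h1, h2⟩ <;> rcases hcases l' hl' with rfl | ⟨hl', h1', h2'⟩
    · rfl
    · exact absurd ha (hsep l' hl' h1' h2' a ha')
    · exact absurd ha' (hsep l hl h1 h2 a ha)
    · exact h.eq_of_mem l hl l' hl' a ha ha'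
  · rw [Finset.disjoint_insert_left]
    refine ⟨fun hc => ?_, h.disjoint.mono_left
      ((Finset.erase_subset _ _).trans (Finset.erase_subset _ _))⟩
    obtain ⟨a, ha⟩ := List.exists_mem_of_ne_nil p (h.ne_nil p hpP)
    have := h.eq_of_mem p hpP _ (Finset.mem_union_right _ hc) a ha (List.mem_append_left _ ha)
    exact h.ne_nil q hqP (List.self_eq_append_right.1 this)
  · have key : [a, b] <:+: p ++ q ↔ [a, b] <:+: p ∨ [a, b] <:+: q ∨ (a = u ∧ b = v) := by
      rw [pair_infix_append, hu, hv]
      simp only [Option.some.injEq, eq_comm]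
    rw [Finset.mem_insert, h.edge_iff, Prod.mk.injEq]
    simp only [Finset.mem_erase, Finset.mem_insert, exists_eq_or_imp, key]
    constructor
    · rintro (hab | ⟨r, hr, hi⟩ | hc)
      · exact Or.inl (Or.inl (Or.inr (Or.inr hab)))
      · by_cases hrp : r = p
        · exact Or.inl (Or.inl (Or.inl (hrp ▸ hi)))
        by_cases hrq : r = q
        · exact Or.inl (Or.inl (Or.inr (Or.inl (hrq ▸ hi))))
        exact Or.inl (Or.inr ⟨r, ⟨hrq, hrp, hr⟩, hi⟩)
      · exact Or.inr hc
    · rintro (((hi | hi | hab) | ⟨r, hr, hi⟩) | hc)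
      · exact Or.inr (Or.inl ⟨p, hp, hi⟩)
      · exact Or.inr (Or.inl ⟨q, hq, hi⟩)
      · exact Or.inl hab
      · exact Or.inr (Or.inl ⟨r, hr.2.2, hi⟩)
      · exact Or.inr (Or.inr hc)

end IsDecomposition

/-- A relation on `U` in which every node has at most one successor and at most one predecessor
decomposes into paths and circles. The edges are added one at a time; the new edge leads from the
last node of a path to the first node of a path. -/
theorem exists_isDecomposition (U : Finset V) (E : Finset (V × V))
    (hU : ∀ u v, (u, v) ∈ E → u ∈ U ∧ v ∈ U)
    (hout : ∀ u v v', (u, v) ∈ E → (u, v') ∈ E → v = v')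
    (hin : ∀ u u' v, (u, v) ∈ E → (u', v) ∈ E → u = u') :
    ∃ P C : Finset (List V), IsDecomposition U E P C := by
  induction E using Finset.induction_on with
  | empty =>
    refine ⟨U.image fun v => [v], ∅, ?_⟩
    constructor
    · simp
    · simp
    · simp
    · simp +contextual
    · simp
    · intro u v
      have : ∀ x, ¬ [u, v] <:+: [x] := fun x h => by simpa using h.length_le
      simp [this]
  | insert e E he ih =>
    obtain ⟨u, v⟩ := e
    have hsub : ∀ {x}, x ∈ E → x ∈ insert (u, v) E := fun h => Finset.mem_insert_of_mem h
    have hnew : (u, v) ∈ insert (u, v) E := Finset.mem_insert_self _ _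
    obtain ⟨P, C, h⟩ := ih (fun a b hab => hU a b (hsub hab))
      (fun a b b' hb hb' => hout a b b' (hsub hb) (hsub hb'))
      (fun a a' b ha ha' => hin a a' b (hsub ha) (hsub ha'))
    obtain ⟨huU, hvU⟩ := hU u v hnew
    obtain ⟨p, hp, hpu⟩ := (h.exists_getLast_iff u).2 ⟨huU, fun w hw =>
      he (hout u w v (hsub hw) hnew ▸ hw)⟩
    obtain ⟨q, hq, hqv⟩ := (h.exists_head_iff v).2 ⟨hvU, fun w hw =>
      he (hin w u v (hsub hw) hnew ▸ hw)⟩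
    by_cases hpq : p = q
    · subst hpq
      exact ⟨_, _, h.close_path hp hpu hqv⟩
    · exact ⟨_, _, h.join_paths hp hq hpq hpu hqv⟩

end Decomposition

/-! ### Path covers from circulations of the node-split network -/

section Flows

variable {V : Type*} [DecidableEq V]

theorem card_filter_eq_ite {α : Type*} (s : Finset α) (p : α → Prop) [DecidablePred p]
    [Decidable (∃ a ∈ s, p a)] (h : ∀ a ∈ s, ∀ b ∈ s, p a → p b → a = b) :
    (s.filter p).card = if ∃ a ∈ s, p a then 1 else 0 := by
  split_ifs with hex
  · obtain ⟨a, ha, hpa⟩ := hex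
    refine Finset.card_eq_one.2 ⟨a, Finset.eq_singleton_iff_unique_mem.2
      ⟨Finset.mem_filter.2 ⟨ha, hpa⟩, fun b hb => ?_⟩⟩
    obtain ⟨hb, hpb⟩ := Finset.mem_filter.1 hb
    exact h b hb a ha hpb hpa
  · exact Finset.card_eq_zero.2 (Finset.filter_eq_empty_iff.2 fun a ha hpa => hex ⟨a, ha, hpa⟩)

theorem isChain_of_pair_infix {α : Type*} {R : α → α → Prop} {l : List α}
    (h : ∀ a b, [a, b] <:+: l → R a b) : l.IsChain R := by
  rw [List.isChain_iff_forall_rel_of_append_cons_cons]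
  rintro a b s t rfl
  exact h a b ⟨s, t, by simp⟩

namespace IsDecomposition

variable {U : Finset V} {E : Finset (V × V)} {P C : Finset (List V)}

theorem cover_eq (h : IsDecomposition U E P C) : cover (P ∪ C) = U := by
  ext v
  simp only [cover, Finset.mem_biUnion, List.mem_toFinset]
  exact (h.mem_iff v).symm

theorem isPathCircleSystem (h : IsDecomposition U E P C) {D : Digraph V}
    (hE : ∀ u v, (u, v) ∈ E → D.Adj u v) : IsPathCircleSystem D P C where
  path p hp := ⟨h.ne_nil p (Finset.mem_union_left _ hp), h.nodup p (Finset.mem_union_left _ hp),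
    isChain_of_pair_infix fun u v huv => hE u v ((h.edge_iff u v).2 (Or.inl ⟨p, hp, huv⟩))⟩
  circle c hc := ⟨h.ne_nil c (Finset.mem_union_right _ hc),
    h.nodup c (Finset.mem_union_right _ hc),
    isChain_of_pair_infix fun u v huv => hE u v ((h.edge_iff u v).2 (Or.inr ⟨c, hc, huv⟩))⟩
  disjoint := by
    rw [cover, Finset.card_biUnion, ← Finset.sum_union h.disjoint]
    · exact Finset.sum_congr rfl fun l hl => List.toFinset_card_of_nodup (h.nodup l hl)
    · intro l hl l' hl' hne
      refine Finset.disjoint_left.2 fun v hv hv' => hne ?_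
      exact h.eq_of_mem l hl l' hl' v (List.mem_toFinset.1 hv) (List.mem_toFinset.1 hv')

theorem inducedFlow_source_nodeIn (h : IsDecomposition U E P C) (v : V)
    [Decidable (v ∈ U ∧ ∀ u, (u, v) ∉ E)] :
    inducedFlow P C .source (.nodeIn v) = if v ∈ U ∧ ∀ u, (u, v) ∉ E then 1 else 0 := by
  classical
  rw [inducedFlow, card_filter_eq_ite]
  · exact if_congr (h.exists_head_iff v) rfl rfl
  · intro p hp q hq hpv hqv
    exact h.eq_of_mem p (Finset.mem_union_left _ hp) q (Finset.mem_union_left _ hq) v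
      (List.mem_of_mem_head? hpv) (List.mem_of_mem_head? hqv)

theorem inducedFlow_nodeOut_sink (h : IsDecomposition U E P C) (u : V)
    [Decidable (u ∈ U ∧ ∀ v, (u, v) ∉ E)] :
    inducedFlow P C (.nodeOut u) .sink = if u ∈ U ∧ ∀ v, (u, v) ∉ E then 1 else 0 := by
  classical
  rw [inducedFlow, card_filter_eq_ite]
  · exact if_congr (h.exists_getLast_iff u) rfl rfl
  · intro p hp q hq hpu hqu
    exact h.eq_of_mem p (Finset.mem_union_left _ hp) q (Finset.mem_union_left _ hq) u
      (List.mem_of_getLast? hpu) (List.mem_of_getLast? hqu)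

/-- Counting the members of `P` and of `C` with properties that force them to contain the node `v`
gives at most one, since `v` is on only one member. -/
theorem card_filter_add_card_filter (h : IsDecomposition U E P C) (φ ψ : List V → Prop)
    [DecidablePred φ] [DecidablePred ψ] (v : V) (hφ : ∀ p, φ p → v ∈ p) (hψ : ∀ c, ψ c → v ∈ c)
    [Decidable ((∃ p ∈ P, φ p) ∨ ∃ c ∈ C, ψ c)] :
    (P.filter φ).card + (C.filter ψ).card =
      if (∃ p ∈ P, φ p) ∨ ∃ c ∈ C, ψ c then 1 else 0 := by
  classical
  rw [card_filter_eq_ite P φ, card_filter_eq_ite C ψ]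
  · by_cases hP : ∃ p ∈ P, φ p
    · by_cases hC : ∃ c ∈ C, ψ c
      · obtain ⟨p, hp, hpv⟩ := hP
        obtain ⟨c, hc, hcv⟩ := hC
        obtain rfl := h.eq_of_mem p (Finset.mem_union_left _ hp) c (Finset.mem_union_right _ hc) v
          (hφ p hpv) (hψ c hcv)
        exact absurd hc (Finset.disjoint_left.1 h.disjoint hp)
      · rw [if_pos hP, if_neg hC, if_pos (Or.inl hP)]
    · by_cases hC : ∃ c ∈ C, ψ c
      · rw [if_neg hP, if_pos hC, if_pos (Or.inr hC)]
      · rw [if_neg hP, if_neg hC, if_neg (not_or.2 ⟨hP, hC⟩)]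
  · intro p hp q hq hpv hqv
    exact h.eq_of_mem p (Finset.mem_union_right _ hp) q (Finset.mem_union_right _ hq) v
      (hψ p hpv) (hψ q hqv)
  · intro p hp q hq hpv hqv
    exact h.eq_of_mem p (Finset.mem_union_left _ hp) q (Finset.mem_union_left _ hq) v
      (hφ p hpv) (hφ q hqv)

theorem inducedFlow_nodeIn_nodeOut (h : IsDecomposition U E P C) (v w : V) :
    inducedFlow P C (.nodeIn v) (.nodeOut w) = if v ∈ U then 1 else 0 := by
  classical
  rw [inducedFlow, h.card_filter_add_card_filter _ _ v (fun _ => id) fun _ => id]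
  simp only [h.mem_iff v, Finset.mem_union, or_and_right, exists_or]

theorem inducedFlow_nodeOut_nodeIn (h : IsDecomposition U E P C) (u v : V) :
    inducedFlow P C (.nodeOut u) (.nodeIn v) = if (u, v) ∈ E then 1 else 0 := by
  classical
  rw [inducedFlow, h.card_filter_add_card_filter _ _ u (fun p hp => hp.subset (by simp))
    fun c hc => (mem_of_pair_infix_circle hc).1]
  simp only [h.edge_iff u v]

theorem inducedFlow_sink_source [Fintype V] (h : IsDecomposition U E P C) :
    inducedFlow P C .sink .source = ∑ v, inducedFlow P C .source (.nodeIn v) := by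
  classical
  simp only [inducedFlow]
  rw [Finset.card_eq_sum_card_fiberwise (f := List.head?)
    (t := Finset.univ.image (some : V → Option V)),
    Finset.sum_image (Option.some_injective V).injOn]
  intro p hp
  obtain ⟨v, t, rfl⟩ := List.exists_cons_of_ne_nil (h.ne_nil p (Finset.mem_union_left _ hp))
  simp

end IsDecomposition

omit [DecidableEq V] in
theorem sum_splitNode {M : Type*} [AddCommMonoid M] [Fintype V] (φ : SplitNode V → M) :
    ∑ a, φ a = φ .source + φ .sink + (∑ v, φ (.nodeIn v) + ∑ v, φ (.nodeOut v)) := by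
  let e : (Unit ⊕ Unit) ⊕ (V ⊕ V) ≃ SplitNode V :=
    { toFun := Sum.elim (Sum.elim (fun _ => .source) fun _ => .sink)
        (Sum.elim .nodeIn .nodeOut)
      invFun := fun a => match a with
        | .source => .inl (.inl ())
        | .sink => .inl (.inr ())
        | .nodeIn v => .inr (.inl v)
        | .nodeOut v => .inr (.inr v)
      left_inv := by rintro ((_ | _) | (_ | _)) <;> rfl
      right_inv := by rintro (_ | _ | _ | _) <;> rfl }
  rw [← e.sum_comp]
  simp [e, Fintype.sum_sum_type]

/-- An integral circulation of the node-split network with node capacities `1` is the induced flow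
of disjoint paths and circles. `U` consists of the nodes `v` whose arc `v^in → v^out` carries flow
and `E` of the arcs `u → v` such that `u^out → v^in` carries flow. -/
theorem exists_isDecomposition_of_circulation [Fintype V] (D : Digraph V)
    (g : SplitNode V → SplitNode V → ℤ) (hcons : ∀ a, ∑ b, g a b = ∑ b, g b a)
    (hoff : ∀ a b, ¬ splitArc D a b → g a b = 0) (hnn : ∀ a b, 0 ≤ g a b)
    (hle : ∀ v, g (.nodeIn v) (.nodeOut v) ≤ 1) :
    ∃ (U : Finset V) (E : Finset (V × V)) (P C : Finset (List V)), IsDecomposition U E P C ∧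
      (∀ u v, (u, v) ∈ E → D.Adj u v) ∧
      ∀ a b, splitArc D a b → (inducedFlow P C a b : ℤ) = g a b := by
  classical
  have hin : ∀ v, g (.nodeIn v) (.nodeOut v) =
      g .source (.nodeIn v) + ∑ u, g (.nodeOut u) (.nodeIn v) := by
    intro v
    have h := hcons (.nodeIn v)
    rw [sum_splitNode, sum_splitNode, hoff (.nodeIn v) .source (by simp [splitArc]),
      hoff (.nodeIn v) .sink (by simp [splitArc]), hoff .sink (.nodeIn v) (by simp [splitArc]),
      Finset.sum_eq_zero (fun w _ => hoff (.nodeIn v) (.nodeIn w) (by simp [splitArc])),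
      Finset.sum_eq_zero (fun w _ => hoff (.nodeIn w) (.nodeIn v) (by simp [splitArc])),
      Finset.sum_eq_single v (fun w _ hw => hoff (.nodeIn v) (.nodeOut w)
        (by simpa [splitArc] using hw.symm)) (by simp)] at h
    simpa using h
  have hout : ∀ v, g (.nodeIn v) (.nodeOut v) =
      g (.nodeOut v) .sink + ∑ w, g (.nodeOut v) (.nodeIn w) := by
    intro v
    have h := hcons (.nodeOut v)
    rw [sum_splitNode, sum_splitNode, hoff (.nodeOut v) .source (by simp [splitArc]),
      hoff .source (.nodeOut v) (by simp [splitArc]), hoff .sink (.nodeOut v) (by simp [splitArc]),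
      Finset.sum_eq_zero (fun w _ => hoff (.nodeOut v) (.nodeOut w) (by simp [splitArc])),
      Finset.sum_eq_zero (fun w _ => hoff (.nodeOut w) (.nodeOut v) (by simp [splitArc])),
      Finset.sum_eq_single (f := fun w => g (.nodeIn w) (.nodeOut v)) v
        (fun w _ hw => hoff (.nodeIn w) (.nodeOut v) (by simpa [splitArc] using hw)) (by simp)] at h
    simpa using h.symm
  have hsrc : g .sink .source = ∑ v, g .source (.nodeIn v) := by
    have h := hcons .source
    rw [sum_splitNode, sum_splitNode, hoff .source .sink (by simp [splitArc]),
      Finset.sum_eq_zero (fun w _ => hoff .source (.nodeOut w) (by simp [splitArc])),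
      Finset.sum_eq_zero (fun w _ => hoff (.nodeOut w) .source (by simp [splitArc])),
      Finset.sum_eq_zero (fun w _ => hoff (.nodeIn w) .source (by simp [splitArc]))] at h
    have h' : g .source .source = 0 := hoff _ _ (by simp [splitArc])
    simpa [h'] using h.symm
  have hle_in : ∀ u v, g (.nodeOut u) (.nodeIn v) ≤ ∑ u, g (.nodeOut u) (.nodeIn v) := fun u v =>
    Finset.single_le_sum (f := fun u => g (.nodeOut u) (.nodeIn v)) (fun _ _ => hnn _ _)
      (Finset.mem_univ u)
  have hle_out : ∀ u v, g (.nodeOut u) (.nodeIn v) ≤ ∑ v, g (.nodeOut u) (.nodeIn v) := fun u v =>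
    Finset.single_le_sum (f := fun v => g (.nodeOut u) (.nodeIn v)) (fun _ _ => hnn _ _)
      (Finset.mem_univ v)
  let U : Finset V := Finset.univ.filter fun v => g (.nodeIn v) (.nodeOut v) = 1
  let E : Finset (V × V) := Finset.univ.filter fun e => g (.nodeOut e.1) (.nodeIn e.2) = 1
  have memU : ∀ v, v ∈ U ↔ g (.nodeIn v) (.nodeOut v) = 1 := fun v => by simp [U]
  have memE : ∀ u v, (u, v) ∈ E ↔ g (.nodeOut u) (.nodeIn v) = 1 := fun u v => by simp [E]
  obtain ⟨P, C, h⟩ := exists_isDecomposition U E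
    (fun u v huv => by
      rw [memU, memU]
      rw [memE] at huv
      have h1 := hle_in u v
      have h2 := hle_out u v
      have := hin v; have := hout u; have := hle u; have := hle v
      have := hnn .source (.nodeIn v); have := hnn (.nodeOut u) .sink
      omega)
    (fun u v v' hv hv' => by
      by_contra hne
      rw [memE] at hv hv'
      have h1 := Finset.sum_le_sum_of_subset_of_nonneg (f := fun v => g (.nodeOut u) (.nodeIn v))
        (Finset.subset_univ {v, v'}) (fun _ _ _ => hnn _ _)
      rw [Finset.sum_pair hne] at h1
      have := hout u; have := hle u; have := hnn (.nodeOut u) .sink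
      omega)
    (fun u u' v hu hu' => by
      by_contra hne
      rw [memE] at hu hu'
      have h1 := Finset.sum_le_sum_of_subset_of_nonneg (f := fun u => g (.nodeOut u) (.nodeIn v))
        (Finset.subset_univ {u, u'}) (fun _ _ _ => hnn _ _)
      rw [Finset.sum_pair hne] at h1
      have := hin v; have := hle v; have := hnn .source (.nodeIn v)
      omega)
  have hs : ∀ v, (inducedFlow P C .source (.nodeIn v) : ℤ) = g .source (.nodeIn v) := by
    intro v
    rw [h.inducedFlow_source_nodeIn]
    simp only [memU]
    have h1 := hin v; have h2 := hle v; have h3 := hnn .source (.nodeIn v)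
    have h5 := hnn (.nodeIn v) (.nodeOut v)
    by_cases hE : ∀ u, (u, v) ∉ E
    · have h4 : ∑ u, g (.nodeOut u) (.nodeIn v) = 0 := Finset.sum_eq_zero fun u _ => by
        have := hE u
        rw [memE] at this
        have := hle_in u v
        have := hnn (.nodeOut u) (.nodeIn v)
        omega
      simp only [hE, not_false_eq_true, implies_true, and_true]
      split_ifs <;> push_cast <;> omega
    · rw [if_neg fun hh => hE hh.2]
      push Not at hE
      obtain ⟨u, hu⟩ := hE
      rw [memE] at hu
      have := hle_in u v
      push_cast
      omega
  refine ⟨U, E, P, C, h, fun u v huv => ?_, fun a b hab => ?_⟩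
  · by_contra hD
    have := (memE u v).1 huv
    rw [hoff _ _ (by simpa [splitArc] using hD)] at this
    exact zero_ne_one this
  · match a, b, hab with
    | .sink, .source, _ =>
      rw [h.inducedFlow_sink_source, hsrc, Nat.cast_sum]
      exact Finset.sum_congr rfl fun v _ => hs v
    | .source, .nodeIn v, _ => exact hs v
    | .nodeIn u, .nodeOut v, huv =>
      obtain rfl : u = v := huv
      rw [h.inducedFlow_nodeIn_nodeOut]
      simp only [memU]
      have := hle u; have := hnn (.nodeIn u) (.nodeOut u)
      split_ifs <;> push_cast <;> omega
    | .nodeOut u, .nodeIn v, _ =>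
      rw [h.inducedFlow_nodeOut_nodeIn]
      simp only [memE]
      have := hle v; have := hnn (.nodeOut u) (.nodeIn v)
      have := hin v; have := hle_in u v; have := hnn .source (.nodeIn v)
      split_ifs <;> push_cast <;> omega
    | .nodeOut u, .sink, _ =>
      rw [h.inducedFlow_nodeOut_sink]
      simp only [memU]
      have h1 := hout u; have h2 := hle u; have h3 := hnn (.nodeOut u) .sink
      have h5 := hnn (.nodeIn u) (.nodeOut u)
      by_cases hE : ∀ v, (u, v) ∉ E
      · have h4 : ∑ v, g (.nodeOut u) (.nodeIn v) = 0 := Finset.sum_eq_zero fun v _ => by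
          have := hE v
          rw [memE] at this
          have := hle_out u v
          have := hnn (.nodeOut u) (.nodeIn v)
          omega
        simp only [hE, not_false_eq_true, implies_true, and_true]
        split_ifs <;> push_cast <;> omega
      · rw [if_neg fun hh => hE hh.2]
        push Not at hE
        obtain ⟨v, hv⟩ := hE
        rw [memE] at hv
        have := hle_out u v
        push_cast
        omega

/-- The path cover obtained by rounding a feasible circulation and decomposing the result. -/
theorem exists_isDecomposition_of_feasible [Fintype V] (D : Digraph V) (S : Finset V)
    (f : SplitNode V → SplitNode V → ℝ) (hf : IsFeasibleCirculation (splitNetwork D S) f) :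
    ∃ (U : Finset V) (E : Finset (V × V)) (P C : Finset (List V)), IsDecomposition U E P C ∧
      (∀ u v, (u, v) ∈ E → D.Adj u v) ∧ S ⊆ U ∧
      ∀ a b, splitArc D a b →
        ⌊f a b⌋ ≤ (inducedFlow P C a b : ℤ) ∧ (inducedFlow P C a b : ℤ) ≤ ⌈f a b⌉ := by
  classical
  let f' : SplitNode V → SplitNode V → ℝ := fun a b => if splitArc D a b then f a b else 0
  have hf' : ∀ a, ∑ b, f' a b = ∑ b, f' b a := by
    intro a
    have h := sub_eq_zero.1 (hf.conservation a)
    rw [Finset.sum_filter, Finset.sum_filter] at h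
    convert h <;> exact Iff.rfl
  obtain ⟨g, hg, hgf⟩ := exists_integral_circulation f' hf'
  have hon : ∀ a b, splitArc D a b → f' a b = f a b := fun a b h => if_pos h
  have hoff : ∀ a b, ¬ splitArc D a b → f' a b = 0 := fun a b h => if_neg h
  have hf0 : ∀ a b, 0 ≤ f' a b := by
    intro a b
    by_cases h : splitArc D a b
    · rw [hon a b h]
      refine le_trans ?_ (hf.lower_le a b h)
      change 0 ≤ splitLower S a b
      unfold splitLower
      split
      · split_ifs <;> norm_num
      · exact le_rfl
    · rw [hoff a b h]
  have hu : ∀ v, f (.nodeIn v) (.nodeOut v) ≤ 1 := fun v => by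
    have h : (f (.nodeIn v) (.nodeOut v) : EReal) ≤ 1 :=
      hf.le_upper (.nodeIn v) (.nodeOut v) (show v = v from rfl)
    exact_mod_cast h
  obtain ⟨U, E, P, C, h, hE, hflow⟩ := exists_isDecomposition_of_circulation D g hg
    (fun a b hab => by
      have := hgf a b
      rw [hoff a b hab, Int.floor_zero, Int.ceil_zero] at this
      omega)
    (fun a b => (Int.floor_nonneg.2 (hf0 a b)).trans (hgf a b).1)
    (fun v => (hgf _ _).2.trans (Int.ceil_le.2 (by
      rw [hon _ _ (show splitArc D (.nodeIn v) (.nodeOut v) from rfl)]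
      exact_mod_cast hu v)))
  refine ⟨U, E, P, C, h, hE, fun v hv => ?_, fun a b hab => ?_⟩
  · have hl : 1 ≤ f (.nodeIn v) (.nodeOut v) := by
      have h : splitLower S (.nodeIn v) (.nodeOut v) ≤ f (.nodeIn v) (.nodeOut v) :=
        hf.lower_le (.nodeIn v) (.nodeOut v) (show v = v from rfl)
      simpa [splitLower, hv] using h
    have hfl : (1 : ℤ) ≤ ⌊f (.nodeIn v) (.nodeOut v)⌋ := Int.le_floor.2 (by exact_mod_cast hl)
    have h1 := (hgf (.nodeIn v) (.nodeOut v)).1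
    rw [hon _ _ (show splitArc D (.nodeIn v) (.nodeOut v) from rfl),
      ← hflow (.nodeIn v) (.nodeOut v) (show v = v from rfl), h.inducedFlow_nodeIn_nodeOut] at h1
    by_contra hvU
    rw [if_neg hvU] at h1
    push_cast at h1
    omega
  · rw [hflow a b hab, ← hon a b hab]
    exact hgf a b

end Flows

/-! ### Generating functions of the impulse responses -/

section Responses

variable {V : Type*} [Fintype V] [DecidableEq V] {ι : Type*}

/-- The generating function `∑ₖ (Aᵏ B) v m Xᵏ` of the impulse response of the node `v` to the
control source `m`. -/
def response (A : Matrix V V ℝ) (B : Matrix V ι ℝ) (v : V) (m : ι) : PowerSeries ℝ :=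
  PowerSeries.mk fun k => (A ^ k * B) v m

theorem response_eq (A : Matrix V V ℝ) (B : Matrix V ι ℝ) (v : V) (m : ι) :
    response A B v m = PowerSeries.C (B v m) +
      PowerSeries.X * ∑ u, PowerSeries.C (A v u) * response A B u m := by
  ext k
  rcases k with - | k
  · simp [response]
  · simp only [response, PowerSeries.coeff_mk, map_add, PowerSeries.coeff_succ_X_mul, map_sum,
      PowerSeries.coeff_C_mul, PowerSeries.coeff_C, Nat.succ_ne_zero, if_false, zero_add]
    rw [pow_succ', Matrix.mul_assoc, Matrix.mul_apply]

/-- If no arc enters `W` from outside, then the responses of the nodes in `W` depend on the rows of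
`W` only. -/
theorem response_congr {A A' : Matrix V V ℝ} {B B' : Matrix V ι ℝ} {W : Finset V}
    (hA : ∀ v ∈ W, ∀ u, A v u = A' v u) (hB : ∀ v ∈ W, ∀ m, B v m = B' v m)
    (hW : ∀ v ∈ W, ∀ u, u ∉ W → A v u = 0) {v : V} (hv : v ∈ W) (m : ι) :
    response A B v m = response A' B' v m := by
  ext k
  simp only [response, PowerSeries.coeff_mk]
  induction k generalizing v with
  | zero => simpa using hB v hv m
  | succ k ih =>
    rw [pow_succ', Matrix.mul_assoc, Matrix.mul_apply, pow_succ', Matrix.mul_assoc,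
      Matrix.mul_apply]
    refine Finset.sum_congr rfl fun u _ => ?_
    by_cases hu : u ∈ W
    · rw [hA v hv, ih hu]
    · rw [← hA v hv, hW v hv u hu, zero_mul, zero_mul]

/-- Along a chain `q 0, …, q (n - 1)` in which each later node is driven, with weight `1`, by its
predecessor alone, the response is delayed by one step per node. -/
theorem response_of_chain {A : Matrix V V ℝ} {B : Matrix V ι ℝ} {n : ℕ} {q : ℕ → V}
    (hA : ∀ i, i + 1 < n → ∀ u, A (q (i + 1)) u = if u = q i then 1 else 0)
    (hB : ∀ i, i + 1 < n → ∀ m, B (q (i + 1)) m = 0) (m : ι) {i : ℕ} (hi : i < n) :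
    response A B (q i) m = PowerSeries.X ^ i * response A B (q 0) m := by
  induction i with
  | zero => simp
  | succ i ih =>
    rw [response_eq, hB i hi, Finset.sum_eq_single (q i), hA i hi, ih (by omega)]
    · simp only [if_pos, map_zero, map_one, zero_add, one_mul]
      ring
    · intro u _ hu
      simp [hA i hi, hu]
    · simp

theorem coe_polynomial_sum {R α : Type*} [CommSemiring R] (s : Finset α) (p : α → Polynomial R) :
    ((∑ i ∈ s, p i : Polynomial R) : PowerSeries R) = ∑ i ∈ s, (p i : PowerSeries R) :=
  map_sum Polynomial.coeToPowerSeries.ringHom p s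

/-- For all but finitely many `c`, no complex root of `P` is a root of `1 - c Xⁿ`. -/
theorem exists_isCoprime_one_sub {n : ℕ} {P : Polynomial ℝ} (hP : P ≠ 0) :
    ∃ c : ℝ, IsCoprime (1 - Polynomial.C c * Polynomial.X ^ n) P ∧ c ≠ 0 := by
  obtain ⟨c, hc⟩ := Infinite.exists_notMem_finset
    (insert 0 ((P.aroots ℂ).toFinset.image fun r => ((r ^ n)⁻¹).re))
  rw [Finset.mem_insert, not_or] at hc
  refine ⟨c, (Polynomial.isCoprime_iff_aeval_ne_zero_of_isAlgClosed ℝ ℂ _ _).2 fun r => ?_, hc.1⟩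
  by_contra! h
  obtain ⟨h1, h2⟩ := h
  refine hc.2 (Finset.mem_image.2 ⟨r, ?_, ?_⟩)
  · rw [Multiset.mem_toFinset, Polynomial.mem_aroots]
    exact ⟨hP, h2⟩
  · have h3 : (c : ℂ) * r ^ n = 1 := by
      simp only [map_sub, map_one, map_mul, Polynomial.aeval_C, map_pow, Polynomial.aeval_X,
        Complex.coe_algebraMap] at h1
      linear_combination -h1
    rw [← eq_inv_of_mul_eq_one_left h3, Complex.ofReal_re]

/-- A polynomial `a` of degree less than `n` with `L R + a P = 0`, where `L = 1 - c Xⁿ` is coprime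
to `P`, is zero, as `L` divides it. -/
theorem eq_zero_of_isCoprime_of_mul_add_mul_eq_zero {n : ℕ} {c : ℝ} (hc : c ≠ 0)
    {P R : Polynomial ℝ} (hcop : IsCoprime (1 - Polynomial.C c * Polynomial.X ^ n) P)
    (a : ℕ → ℝ)
    (h : (1 - Polynomial.C c * Polynomial.X ^ n) * R +
      (∑ i ∈ Finset.range n, Polynomial.C (a i) * Polynomial.X ^ i) * P = 0) :
    ∀ i < n, a i = 0 := by
  intro i hi
  set s : Polynomial ℝ := ∑ i ∈ Finset.range n, Polynomial.C (a i) * Polynomial.X ^ i with hs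
  have hdvd : 1 - Polynomial.C c * Polynomial.X ^ n ∣ s :=
    hcop.dvd_of_dvd_mul_right ⟨-R, by linear_combination h⟩
  have hdeg : (1 - Polynomial.C c * Polynomial.X ^ n : Polynomial ℝ).degree = n := by
    rw [Polynomial.degree_sub_eq_right_of_degree_lt, Polynomial.degree_C_mul_X_pow n hc]
    rw [Polynomial.degree_C_mul_X_pow n hc, Polynomial.degree_one]
    exact_mod_cast (Nat.zero_le i).trans_lt hi
  have hs0 : s = 0 := by
    refine Polynomial.eq_zero_of_dvd_of_degree_lt hdvd ?_
    rw [hdeg]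
    refine (Polynomial.degree_sum_le _ _).trans_lt ((Finset.sup_lt_iff ?_).2 fun j hj => ?_)
    · exact WithBot.bot_lt_coe n
    · exact (Polynomial.degree_C_mul_X_pow_le _ _).trans_lt
        (by exact_mod_cast Finset.mem_range.1 hj)
  have := congrArg (fun p => Polynomial.coeff p i) hs0
  simpa [hs, Polynomial.finsetSum_coeff, Polynomial.coeff_C_mul, Polynomial.coeff_X_pow, hi]
    using this

end Responses

/-! ### Subsystems with independent responses -/

section Substructures

variable {V : Type*} [Fintype V] [DecidableEq V] {ι : Type*}

/-- `(A₀, B₀)` uses only connections of `(A, B)`, no arc of `A₀` enters `W` from outside, every node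
of `W` responds to some control source, the responses of `W` are rational functions with common
denominator `Q`, and the responses of the nodes in `U ∩ W` (each being the vector of its responses
to all the sources) are linearly independent. The weights `w` of a linear relation are indexed by
all nodes, and vanish outside `U ∩ W`. -/
structure IsIndependentSubsystem (A : Matrix V V ℝ) (B : Matrix V ι ℝ) (U W : Finset V)
    (A₀ : Matrix V V ℝ) (B₀ : Matrix V ι ℝ) : Prop where
  state : ∀ v u, A v u = 0 → A₀ v u = 0
  input : ∀ v m, B v m = 0 → B₀ v m = 0
  closed : ∀ v ∈ W, ∀ u, u ∉ W → A₀ v u = 0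
  rational : ∃ Q : Polynomial ℝ, Q ≠ 0 ∧ ∀ v ∈ W, ∀ m,
    ∃ p : Polynomial ℝ, (Q : PowerSeries ℝ) * response A₀ B₀ v m = p
  ne_zero : ∀ v ∈ W, ∃ m, response A₀ B₀ v m ≠ 0
  independent : ∀ w : V → ℝ, (∀ v, v ∉ U ∩ W → w v = 0) →
    (∀ m, ∑ v, PowerSeries.C (w v) * response A₀ B₀ v m = 0) → ∀ v, w v = 0

/-- A chain `q 0, …, q (n - 1)` outside `W`, which can be entered at `q 0` from `W` or from a
control source, can be added to an independent subsystem if it avoids `U`, or if it can be closed to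
a circle by an arc `q (n - 1) → q 0`. In the latter case the weight `c` of the closing arc matters:
with `L = 1 - c Xⁿ`, the node `q i` has the response `Xⁱ H / L`, where `H` is the response with
which the chain is entered, and `c` is chosen such that `L` is coprime to the numerator of a nonzero
component of `H`. A linear relation among the responses then involves no node of the chain, since
its coefficients there would form a polynomial of degree less than `n` that is divisible by `L`. -/
theorem IsIndependentSubsystem.extend {A A₀ : Matrix V V ℝ} {B B₀ : Matrix V ι ℝ} {U W : Finset V}
    (h : IsIndependentSubsystem A B U W A₀ B₀) {n : ℕ} (hn : 0 < n) {q : ℕ → V}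
    (hinj : ∀ i < n, ∀ j < n, q i = q j → i = j) (hqW : ∀ i < n, q i ∉ W)
    (hqA : ∀ i, i + 1 < n → A (q (i + 1)) (q i) ≠ 0)
    (hqU : (∀ i < n, q i ∉ U) ∨ A (q 0) (q (n - 1)) ≠ 0)
    (hentry : (∃ u ∈ W, A (q 0) u ≠ 0) ∨ ∃ m, B (q 0) m ≠ 0) :
    ∃ A₁ B₁, IsIndependentSubsystem A B U (W ∪ (Finset.range n).image q) A₁ B₁ := by
  classical
  obtain ⟨Q, hQ, hrat⟩ := h.rational
  -- the weights `α`, `β` of the arcs through which the chain is entered, and their response `H`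
  obtain ⟨α, β, hαW, hαA, hβB, m₀, hH⟩ : ∃ (α : V → ℝ) (β : ι → ℝ), (∀ u, u ∉ W → α u = 0) ∧
      (∀ u, A (q 0) u = 0 → α u = 0) ∧ (∀ m, B (q 0) m = 0 → β m = 0) ∧
      ∃ m, PowerSeries.C (β m) + PowerSeries.X *
        ∑ u, PowerSeries.C (α u) * response A₀ B₀ u m ≠ 0 := by
    rcases hentry with ⟨u, huW, hu⟩ | ⟨m, hm⟩
    · obtain ⟨m, hm⟩ := h.ne_zero u huW
      refine ⟨Pi.single u 1, 0, fun v hv => ?_, fun v hv => ?_, fun _ _ => rfl, m, ?_⟩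
      · exact Pi.single_eq_of_ne (by rintro rfl; exact hv huW) _
      · exact Pi.single_eq_of_ne (by rintro rfl; exact hu hv) _
      · rw [Finset.sum_eq_single u (fun v _ hv => by simp [Pi.single_eq_of_ne hv]) (by simp)]
        simpa using hm
    · refine ⟨0, Pi.single m 1, fun _ _ => rfl, fun _ _ => rfl, fun v hv => ?_, m, by simp⟩
      exact Pi.single_eq_of_ne (by rintro rfl; exact hm hv) _
  set H : ι → PowerSeries ℝ := fun m => PowerSeries.C (β m) + PowerSeries.X *
    ∑ u, PowerSeries.C (α u) * response A₀ B₀ u m with hHdef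
  have hH : H m₀ ≠ 0 := hH
  have hratH : ∀ m, ∃ p : Polynomial ℝ, (Q : PowerSeries ℝ) * H m = p := by
    intro m
    choose! p hp using fun v (hv : v ∈ W) => hrat v hv m
    refine ⟨Q * Polynomial.C (β m) + Polynomial.X *
      ∑ u, Polynomial.C (α u) * p u, ?_⟩
    have hsum : (Q : PowerSeries ℝ) * ∑ u, PowerSeries.C (α u) * response A₀ B₀ u m =
        ((∑ u, Polynomial.C (α u) * p u : Polynomial ℝ) : PowerSeries ℝ) := by
      rw [Finset.mul_sum, coe_polynomial_sum]
      refine Finset.sum_congr rfl fun u _ => ?_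
      by_cases hu : u ∈ W
      · rw [Polynomial.coe_mul, Polynomial.coe_C, ← hp u hu]
        ring
      · simp [hαW u hu]
    rw [Polynomial.coe_add, Polynomial.coe_mul, Polynomial.coe_mul, ← hsum, Polynomial.coe_C,
      Polynomial.coe_X, hHdef]
    ring
  obtain ⟨P, hP⟩ := hratH m₀
  have hP0 : P ≠ 0 := by
    rintro rfl
    rw [Polynomial.coe_zero, mul_eq_zero] at hP
    exact hP.elim (fun h => hQ (Polynomial.coe_eq_zero_iff.1 h)) hH
  -- the weight of the arc that closes the chain
  obtain ⟨c, hcA, hc⟩ : ∃ c : ℝ, (A (q 0) (q (n - 1)) = 0 → c = 0) ∧ ((∀ i < n, q i ∉ U) ∨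
      (IsCoprime (1 - Polynomial.C c * Polynomial.X ^ n) P ∧ c ≠ 0)) := by
    rcases hqU with hqU | hqU
    · exact ⟨0, fun _ => rfl, Or.inl hqU⟩
    · obtain ⟨c, hc⟩ := exists_isCoprime_one_sub (n := n) hP0
      exact ⟨c, fun h0 => absurd h0 hqU, Or.inr hc⟩
  let A₁ : Matrix V V ℝ := fun v u => if v ∈ W then A₀ v u else
    if v = q 0 then α u + (if u = q (n - 1) then c else 0) else
      if ∃ i, i + 1 < n ∧ v = q (i + 1) ∧ u = q i then 1 else 0
  let B₁ : Matrix V ι ℝ := fun v m => if v ∈ W then B₀ v m else if v = q 0 then β m else 0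
  have hq0 : ∀ i, i + 1 < n → q (i + 1) ≠ q 0 := fun i hi he =>
    absurd (hinj _ hi 0 hn he) (Nat.succ_ne_zero i)
  have hold : ∀ v ∈ W, ∀ m, response A₁ B₁ v m = response A₀ B₀ v m := fun v hv m =>
    (response_congr (fun v hv u => (if_pos hv).symm) (fun v hv m => (if_pos hv).symm)
      h.closed hv m).symm
  have hA₁q : ∀ i, i + 1 < n → ∀ u, A₁ (q (i + 1)) u = if u = q i then 1 else 0 := by
    intro i hi u
    simp only [A₁, if_neg (hqW _ hi), if_neg (hq0 i hi)]
    refine if_congr ⟨?_, fun hu => ⟨i, hi, rfl, hu⟩⟩ rfl rfl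
    rintro ⟨j, hj, hij, rfl⟩
    rw [Nat.succ_injective (hinj _ hi _ hj hij)]
  have hB₁q : ∀ i, i + 1 < n → ∀ m, B₁ (q (i + 1)) m = 0 := by
    intro i hi m
    simp only [B₁, if_neg (hqW _ hi), if_neg (hq0 i hi)]
  have hchain : ∀ m, ∀ i < n, response A₁ B₁ (q i) m =
      PowerSeries.X ^ i * response A₁ B₁ (q 0) m := fun m i hi =>
    response_of_chain hA₁q hB₁q m hi
  have hloop : ∀ m, ((1 - Polynomial.C c * Polynomial.X ^ n : Polynomial ℝ) : PowerSeries ℝ) *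
      response A₁ B₁ (q 0) m = H m := by
    intro m
    have h1 := response_eq A₁ B₁ (q 0) m
    have h2 : ∑ u, PowerSeries.C (A₁ (q 0) u) * response A₁ B₁ u m =
        ∑ u, PowerSeries.C (α u) * response A₀ B₀ u m +
          PowerSeries.C c * response A₁ B₁ (q (n - 1)) m := by
      have h3 : ∀ u, PowerSeries.C (A₁ (q 0) u) * response A₁ B₁ u m =
          PowerSeries.C (α u) * response A₀ B₀ u m +
            (if u = q (n - 1) then PowerSeries.C c * response A₁ B₁ u m else 0) := by
        intro u
        have h4 : PowerSeries.C (α u) * response A₁ B₁ u m =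
            PowerSeries.C (α u) * response A₀ B₀ u m := by
          by_cases hu : u ∈ W
          · rw [hold u hu]
          · simp [hαW u hu]
        simp only [A₁, if_neg (hqW 0 hn), if_true, map_add, add_mul, h4]
        split_ifs <;> simp
      rw [Finset.sum_congr rfl fun u _ => h3 u, Finset.sum_add_distrib]
      simp
    have h5 : B₁ (q 0) m = β m := by simp only [B₁, if_neg (hqW 0 hn), if_true]
    rw [h2, h5, hchain m (n - 1) (by omega)] at h1
    have h6 : (PowerSeries.X : PowerSeries ℝ) ^ n = PowerSeries.X * PowerSeries.X ^ (n - 1) := by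
      rw [← pow_succ', Nat.sub_add_cancel hn]
    simp only [Polynomial.coe_sub, Polynomial.coe_one, Polynomial.coe_mul, Polynomial.coe_C,
      Polynomial.coe_pow, Polynomial.coe_X, h6, hHdef]
    linear_combination h1
  set L : Polynomial ℝ := 1 - Polynomial.C c * Polynomial.X ^ n with hL
  have hL0 : L ≠ 0 := by
    intro h0
    have := congrArg (Polynomial.eval 0) h0
    simp [hL, hn.ne'] at this
  have hnew : ∀ v ∈ W ∪ (Finset.range n).image q, v ∈ W ∨ ∃ i < n, v = q i := by
    intro v hv
    rcases Finset.mem_union.1 hv with hv | hv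
    · exact Or.inl hv
    · obtain ⟨i, hi, rfl⟩ := Finset.mem_image.1 hv
      exact Or.inr ⟨i, Finset.mem_range.1 hi, rfl⟩
  have hqmem : ∀ i < n, q i ∈ W ∪ (Finset.range n).image q := fun i hi =>
    Finset.mem_union_right _ (Finset.mem_image_of_mem q (Finset.mem_range.2 hi))
  refine ⟨A₁, B₁, fun v u hvu => ?_, fun v m hvm => ?_, fun v hv u hu => ?_,
    ⟨Q * L, mul_ne_zero hQ hL0, fun v hv m => ?_⟩, fun v hv => ?_, fun w hw hsum => ?_⟩
  · simp only [A₁]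
    split_ifs with h1 h2 h3 h4
    · exact h.state v u hvu
    · subst h2
      subst h3
      rw [hαA _ hvu, hcA hvu, add_zero]
    · subst h2
      rw [hαA _ hvu, add_zero]
    · obtain ⟨i, hi, rfl, rfl⟩ := h4
      exact absurd hvu (hqA i hi)
    · rfl
  · simp only [B₁]
    split_ifs with h1 h2
    · exact h.input v m hvm
    · subst h2
      exact hβB m hvm
    · rfl
  · have huW : u ∉ W := fun h1 => hu (Finset.mem_union_left _ h1)
    have huq : ∀ i < n, u ≠ q i := fun i hi he => hu (he ▸ hqmem i hi)
    rcases hnew v hv with hv | ⟨i, hi, rfl⟩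
    · simp only [A₁, if_pos hv]
      exact h.closed v hv u huW
    · rcases i with - | i
      · simp only [A₁, if_neg (hqW 0 hn), if_true, hαW u huW, if_neg (huq (n - 1) (by omega)),
          add_zero]
      · rw [hA₁q i hi, if_neg (huq i (by omega))]
  · rcases hnew v hv with hv | ⟨i, hi, rfl⟩
    · obtain ⟨p, hp⟩ := hrat v hv m
      refine ⟨L * p, ?_⟩
      rw [hold v hv, Polynomial.coe_mul, Polynomial.coe_mul, ← hp]
      ring
    · obtain ⟨p, hp⟩ := hratH m
      refine ⟨Polynomial.X ^ i * p, ?_⟩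
      rw [hchain m i hi, Polynomial.coe_mul, Polynomial.coe_mul, ← hp, ← hloop m,
        Polynomial.coe_pow, Polynomial.coe_X]
      ring
  · rcases hnew v hv with hv | ⟨i, hi, rfl⟩
    · obtain ⟨m, hm⟩ := h.ne_zero v hv
      exact ⟨m, by rwa [hold v hv]⟩
    · refine ⟨m₀, fun h0 => hH ?_⟩
      rw [hchain m₀ i hi, mul_eq_zero] at h0
      rw [← hloop m₀, h0.resolve_left (pow_ne_zero _ PowerSeries.X_ne_zero), mul_zero]
  · -- split the relation into the part on `W` and the part on the chain
    have hsplit : ∀ m, ∑ v, PowerSeries.C (w v) * response A₁ B₁ v m =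
        ∑ v ∈ W, PowerSeries.C (w v) * response A₀ B₀ v m +
          (∑ i ∈ Finset.range n, PowerSeries.C (w (q i)) * PowerSeries.X ^ i) *
            response A₁ B₁ (q 0) m := by
      intro m
      rw [← Finset.sum_subset (Finset.subset_univ (W ∪ (Finset.range n).image q)),
        Finset.sum_union, Finset.sum_image, Finset.sum_mul]
      · congr 1
        · exact Finset.sum_congr rfl fun v hv => by rw [hold v hv]
        · refine Finset.sum_congr rfl fun i hi => ?_
          rw [hchain m i (Finset.mem_range.1 hi), mul_assoc]
      · intro i hi j hj he
        exact hinj i (Finset.mem_range.1 hi) j (Finset.mem_range.1 hj) he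
      · refine Finset.disjoint_left.2 fun v hv hv' => ?_
        obtain ⟨i, hi, rfl⟩ := Finset.mem_image.1 hv'
        exact hqW i (Finset.mem_range.1 hi) hv
      · intro v _ hv
        rw [hw v fun h1 => hv (Finset.mem_inter.1 h1).2, map_zero, zero_mul]
    have hwq : ∀ i < n, w (q i) = 0 := by
      rcases hc with hc | ⟨hcop, hc0⟩
      · exact fun i hi => hw _ fun h1 => hc i hi (Finset.mem_inter.1 h1).1
      · choose! p hp using fun v (hv : v ∈ W) => hrat v hv m₀
        refine eq_zero_of_isCoprime_of_mul_add_mul_eq_zero hc0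
          (R := ∑ v ∈ W, Polynomial.C (w v) * p v) hcop (fun i => w (q i)) ?_
        rw [← Polynomial.coe_eq_zero_iff]
        have h1 : ((∑ v ∈ W, Polynomial.C (w v) * p v : Polynomial ℝ) : PowerSeries ℝ) =
            Q * ∑ v ∈ W, PowerSeries.C (w v) * response A₀ B₀ v m₀ := by
          rw [coe_polynomial_sum, Finset.mul_sum]
          refine Finset.sum_congr rfl fun v hv => ?_
          rw [Polynomial.coe_mul, Polynomial.coe_C, ← hp v hv]
          ring
        have h2 : ((∑ i ∈ Finset.range n, Polynomial.C (w (q i)) * Polynomial.X ^ i :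
            Polynomial ℝ) : PowerSeries ℝ) =
            ∑ i ∈ Finset.range n, PowerSeries.C (w (q i)) * PowerSeries.X ^ i := by
          rw [coe_polynomial_sum]
          exact Finset.sum_congr rfl fun i _ => by simp
        have h3 := (hsplit m₀).symm.trans (hsum m₀)
        rw [Polynomial.coe_add, Polynomial.coe_mul, Polynomial.coe_mul, h1, h2, ← hP, ← hloop m₀]
        linear_combination (L : PowerSeries ℝ) * Q * h3
    refine h.independent w (fun v hv => ?_) fun m => ?_
    · by_cases hvT : ∃ i < n, v = q i
      · obtain ⟨i, hi, rfl⟩ := hvT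
        exact hwq i hi
      · refine hw v fun h1 => hv ?_
        obtain ⟨h1, h2⟩ := Finset.mem_inter.1 h1
        exact Finset.mem_inter.2 ⟨h1, (hnew v h2).resolve_right hvT⟩
    · have h3 := (hsplit m).symm.trans (hsum m)
      rw [Finset.sum_eq_zero (s := Finset.range n)
        (fun i hi => by rw [hwq i (Finset.mem_range.1 hi), map_zero, zero_mul]), zero_mul,
        add_zero] at h3
      rw [← h3]
      refine (Finset.sum_subset (Finset.subset_univ W) fun v _ hv => ?_).symm
      by_cases hvT : ∃ i < n, v = q i
      · obtain ⟨i, hi, rfl⟩ := hvT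
        rw [hwq i hi, map_zero, zero_mul]
      · rw [hw v fun h1 => ((hnew v (Finset.mem_inter.1 h1).2).elim hv hvT), map_zero, zero_mul]

end Substructures

/-! ### Growing a subsystem along accessible nodes -/

section Circles

variable {V : Type*} [DecidableEq V]

/-- A circle can be traversed starting from any of its nodes. -/
theorem exists_circle_enumeration {D : Digraph V} {l : List V} (hnodup : l.Nodup)
    (hD : ∀ u v, [u, v] <:+: l ++ l.take 1 → D.Adj u v) {y : V} (hy : y ∈ l) :
    ∃ q : ℕ → V, q 0 = y ∧ (∀ i < l.length, ∀ j < l.length, q i = q j → i = j) ∧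
      (∀ i, D.Adj (q i) (q (i + 1))) ∧ q l.length = q 0 ∧
      (Finset.range l.length).image q = l.toFinset := by
  have hn : 0 < l.length := List.length_pos_of_mem hy
  obtain ⟨j₀, hj₀, rfl⟩ := List.getElem_of_mem hy
  have hlt : ∀ i, (i + j₀) % l.length < l.length := fun i => Nat.mod_lt _ hn
  let q : ℕ → V := fun i => l[(i + j₀) % l.length]'(hlt i)
  have hinj : ∀ i < l.length, ∀ j < l.length, q i = q j → i = j := by
    intro i hi j hj hij
    have h : i + j₀ ≡ j + j₀ [MOD l.length] := (hnodup.getElem_inj_iff).1 hij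
    have h' : i ≡ j [MOD l.length] := Nat.ModEq.add_right_cancel' j₀ h
    rwa [Nat.ModEq, Nat.mod_eq_of_lt hi, Nat.mod_eq_of_lt hj] at h'
  have hstep : ∀ k (hk : k < l.length), D.Adj l[k] (l[(k + 1) % l.length]'(Nat.mod_lt _ hn)) := by
    intro k hk
    apply hD
    obtain ⟨x, y, hx, hy, hxy⟩ := pair_infix_circle_of_nonempty (List.length_pos_iff.1 hn)
    rw [hxy]
    by_cases hk' : k + 1 < l.length
    · left
      simp only [Nat.mod_eq_of_lt hk']
      refine ⟨l.take k, l.drop (k + 2), ?_⟩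
      simp
    · right
      obtain hk1 : k + 1 = l.length := by omega
      simp only [hk1, Nat.mod_self]
      rw [List.getLast?_eq_getElem?] at hx
      rw [List.head?_eq_getElem?] at hy
      have hk2 : l.length - 1 = k := by omega
      rw [hk2, List.getElem?_eq_getElem hk] at hx
      rw [List.getElem?_eq_getElem hn] at hy
      exact ⟨Option.some.inj hx, Option.some.inj hy⟩
  refine ⟨q, ?_, hinj, fun i => ?_, ?_, ?_⟩
  · simp only [q, zero_add, Nat.mod_eq_of_lt hj₀]
  · have h := hstep _ (hlt i)
    have he : ((i + j₀) % l.length + 1) % l.length = (i + 1 + j₀) % l.length := by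
      rw [Nat.mod_add_mod, add_right_comm]
    simp only [he] at h
    exact h
  · simp only [q, zero_add, Nat.add_mod_left]
  · refine Finset.eq_of_subset_of_card_le (fun v hv => ?_) ?_
    · obtain ⟨i, -, rfl⟩ := Finset.mem_image.1 hv
      exact List.mem_toFinset.2 (List.getElem_mem _)
    · rw [Finset.card_image_of_injOn, Finset.card_range]
      · exact List.toFinset_card_le l
      · intro i hi j hj hij
        exact hinj i (Finset.mem_range.1 hi) j (Finset.mem_range.1 hj) hij

end Circles

section Growth

variable {V : Type*} [DecidableEq V] {ι : Type*}

/-- A directed path from a control source to a node outside `W` has a node outside `W` that is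
entered from `W` or from a control source. -/
theorem Accessible.exists_entry {A : Matrix V V ℝ} {B : Matrix V ι ℝ} {v : V}
    (h : Accessible A B v) {W : Finset V} (hv : v ∉ W) :
    ∃ y, y ∉ W ∧ ((∃ u ∈ W, A y u ≠ 0) ∨ ∃ m, B y m ≠ 0) := by
  obtain ⟨m, h⟩ := h
  suffices H : ∀ z, Relation.ReflTransGen (systemDigraph A B).Adj (Sum.inr m) z →
      ∀ x, z = Sum.inl x → x ∉ W → ∃ y, y ∉ W ∧ ((∃ u ∈ W, A y u ≠ 0) ∨ ∃ m, B y m ≠ 0) from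
    H _ h v rfl hv
  intro z hz
  induction hz with
  | refl => exact fun x hx => by simp at hx
  | @tail y z hy hyz ih =>
    rintro x rfl hx
    match y, hyz, ih with
    | .inl u, hyz, ih =>
      by_cases hu : u ∈ W
      · exact ⟨x, hx, Or.inl ⟨u, hu, hyz⟩⟩
      · exact ih u rfl hu
    | .inr m', hyz, ih => exact ⟨x, hx, Or.inr ⟨m', hyz⟩⟩

namespace IsDecomposition

variable {U : Finset V} {E : Finset (V × V)} {P C : Finset (List V)}

/-- The paths alone form an independent subsystem: the `i`-th node of the path `p` responds with
`Xⁱ` to the source `σ p` of this path, and not at all to other sources. -/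
theorem exists_subsystem_paths [Fintype V] (h : IsDecomposition U E P C) {A : Matrix V V ℝ}
    {B : Matrix V ι ℝ} (hA : ∀ u v, (u, v) ∈ E → A v u ≠ 0) (σ : P → ι)
    (hσ : Function.Injective σ) (hB : ∀ p : P, ∀ v ∈ (p : List V).head?, B v (σ p) ≠ 0) :
    ∃ A₀ B₀, IsIndependentSubsystem A B U (cover P) A₀ B₀ := by
  classical
  let A₀ : Matrix V V ℝ := fun v u => if ∃ p ∈ P, [u, v] <:+: p then 1 else 0
  let B₀ : Matrix V ι ℝ := fun v m =>
    if ∃ p : P, (p : List V).head? = some v ∧ σ p = m then 1 else 0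
  have hPU : ∀ p ∈ P, p ∈ P ∪ C := fun p hp => Finset.mem_union_left _ hp
  have mem_cover : ∀ v, v ∈ cover P ↔ ∃ p ∈ P, v ∈ p := fun v => by simp [cover]
  have hex : ∀ v ∈ cover P, ∃ p : P, ∃ i, ∃ hi : i < p.1.length, v = p.1[i] := by
    intro v hv
    obtain ⟨p, hp, hvp⟩ := (mem_cover v).1 hv
    obtain ⟨i, hi, rfl⟩ := List.getElem_of_mem hvp
    exact ⟨⟨p, hp⟩, i, hi, rfl⟩
  have huniq : ∀ p q : P, ∀ v, v ∈ p.1 → v ∈ q.1 → p = q := fun p q v hp hq =>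
    Subtype.ext (h.eq_of_mem p.1 (hPU _ p.2) q.1 (hPU _ q.2) v hp hq)
  have hresp : ∀ (p : P) (m : ι) (i : ℕ) (hi : i < p.1.length),
      response A₀ B₀ p.1[i] m = if σ p = m then PowerSeries.X ^ i else 0 := by
    intro p m i
    induction i with
    | zero =>
      intro hi
      have hhead : p.1.head? = some p.1[0] := by
        rw [List.head?_eq_getElem?, List.getElem?_eq_getElem hi]
      have h1 : ∀ u, A₀ p.1[0] u = 0 := by
        intro u
        refine if_neg ?_
        rintro ⟨q, hq, hu⟩
        obtain rfl := huniq p ⟨q, hq⟩ p.1[0] (List.getElem_mem hi) (hu.subset (by simp))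
        exact head_ne_of_pair_infix (h.nodup _ (hPU _ hq)) hu hhead
      have h2 : B₀ p.1[0] m = if σ p = m then 1 else 0 := by
        refine if_congr ⟨?_, fun hm => ⟨p, hhead, hm⟩⟩ rfl rfl
        rintro ⟨q, hq, hm⟩
        rwa [huniq p q p.1[0] (List.getElem_mem hi) (List.mem_of_mem_head? hq)]
      rw [response_eq, h2]
      simp only [h1, map_zero, zero_mul, Finset.sum_const_zero, mul_zero, add_zero, pow_zero]
      split_ifs <;> simp
    | succ i ih =>
      intro hi
      have h1 : ∀ u, A₀ p.1[i + 1] u = if u = p.1[i] then 1 else 0 := by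
        intro u
        refine if_congr ⟨?_, fun hu => ⟨p.1, p.2,
          (pair_infix_getElem_iff (h.nodup _ (hPU _ p.2)) hi u).2 hu⟩⟩ rfl rfl
        rintro ⟨q, hq, hu⟩
        obtain rfl := huniq p ⟨q, hq⟩ p.1[i + 1] (List.getElem_mem hi) (hu.subset (by simp))
        exact (pair_infix_getElem_iff (h.nodup _ (hPU _ hq)) hi u).1 hu
      have h2 : B₀ p.1[i + 1] m = 0 := by
        refine if_neg ?_
        rintro ⟨q, hq, -⟩
        obtain rfl := huniq p q p.1[i + 1] (List.getElem_mem hi) (List.mem_of_mem_head? hq)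
        rw [List.head?_eq_getElem?, List.getElem?_eq_getElem (by omega), Option.some.injEq,
          (h.nodup _ (hPU _ p.2)).getElem_inj_iff] at hq
        omega
      rw [response_eq, h2, Finset.sum_eq_single p.1[i], h1, if_pos rfl, ih (by omega)]
      · split_ifs <;> simp [pow_succ']
      · intro u _ hu
        rw [h1, if_neg hu, map_zero, zero_mul]
      · simp
  refine ⟨A₀, B₀, fun v u hvu => if_neg ?_, fun v m hvm => if_neg ?_, fun v hv u hu => if_neg ?_,
    ⟨1, one_ne_zero, fun v hv m => ?_⟩, fun v hv => ?_, fun w hw hsum v => ?_⟩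
  · rintro ⟨p, hp, hi⟩
    exact hA u v ((h.edge_iff u v).2 (Or.inl ⟨p, hp, hi⟩)) hvu
  · rintro ⟨p, hp, rfl⟩
    exact hB p v hp hvm
  · rintro ⟨p, hp, hi⟩
    exact hu ((mem_cover u).2 ⟨p, hp, hi.subset (by simp)⟩)
  · obtain ⟨p, i, hi, rfl⟩ := hex v hv
    refine ⟨if σ p = m then Polynomial.X ^ i else 0, ?_⟩
    rw [hresp p m i hi]
    split_ifs <;> simp
  · obtain ⟨p, i, hi, rfl⟩ := hex v hv
    refine ⟨σ p, ?_⟩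
    rw [hresp p _ i hi, if_pos rfl]
    exact pow_ne_zero _ PowerSeries.X_ne_zero
  · by_cases hv : v ∈ cover P
    · obtain ⟨p, i, hi, rfl⟩ := hex v hv
      have h1 := congrArg (PowerSeries.coeff i) (hsum (σ p))
      rw [map_sum, Finset.sum_eq_single p.1[i], PowerSeries.coeff_C_mul, hresp p _ i hi,
        if_pos rfl, PowerSeries.coeff_X_pow_self, mul_one, map_zero] at h1
      · exact h1
      · intro u _ hu
        by_cases huP : u ∈ cover P
        · obtain ⟨q, j, hj, rfl⟩ := hex u huP
          rw [PowerSeries.coeff_C_mul, hresp q _ j hj]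
          split_ifs with hqp
          · obtain rfl := hσ hqp
            rw [PowerSeries.coeff_X_pow, if_neg, mul_zero]
            rintro rfl
            exact hu rfl
          · simp
        · rw [hw u fun h1 => huP (Finset.mem_inter.1 h1).2, map_zero, zero_mul, map_zero]
      · simp
    · exact hw v fun h1 => hv (Finset.mem_inter.1 h1).2

/-- Starting from the paths, circles and uncovered nodes are added along arcs from the nodes or
sources at hand until all of `U` is covered; this succeeds as all circles are accessible. -/
theorem exists_subsystem [Fintype V] [Fintype ι] (h : IsDecomposition U E P C) {A : Matrix V V ℝ}
    {B : Matrix V ι ℝ} (hA : ∀ u v, (u, v) ∈ E → A v u ≠ 0)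
    (hB : ControlSourcesAttached A B P C) :
    ∃ (W : Finset V) (A₀ : Matrix V V ℝ) (B₀ : Matrix V ι ℝ),
      U ⊆ W ∧ IsIndependentSubsystem A B U W A₀ B₀ := by
  obtain ⟨σ, hσ, hBσ⟩ := hB.paths
  obtain ⟨A₀, B₀, h₀⟩ := h.exists_subsystem_paths hA σ hσ hBσ
  have hC : ∀ c ∈ C, (∃ v ∈ c, v ∈ cover P) → ∀ v ∈ c, v ∈ cover P := by
    rintro c hc ⟨v, hvc, hv⟩
    obtain ⟨p, hp, hvp⟩ := Finset.mem_biUnion.1 hv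
    obtain rfl := h.eq_of_mem c (Finset.mem_union_right _ hc) p (Finset.mem_union_left _ hp) v hvc
      (List.mem_toFinset.1 hvp)
    exact absurd hc (Finset.disjoint_left.1 h.disjoint hp)
  suffices H : ∀ k (W : Finset V) (A₀ : Matrix V V ℝ) (B₀ : Matrix V ι ℝ),
      (Finset.univ \ W).card = k → cover P ⊆ W → IsIndependentSubsystem A B U W A₀ B₀ →
      (∀ c ∈ C, (∃ v ∈ c, v ∈ W) → ∀ v ∈ c, v ∈ W) →
      ∃ (W : Finset V) (A₀ : Matrix V V ℝ) (B₀ : Matrix V ι ℝ),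
        U ⊆ W ∧ IsIndependentSubsystem A B U W A₀ B₀ from
    H _ (cover P) A₀ B₀ rfl (Finset.Subset.refl _) h₀ hC
  clear h₀ hC A₀ B₀
  intro k
  induction k using Nat.strong_induction_on with
  | _ k ih =>
  intro W A₀ B₀ hk hP h₀ hC
  by_cases hUW : U ⊆ W
  · exact ⟨W, A₀, B₀, hUW, h₀⟩
  have hcirc : ∀ v ∈ U, v ∉ W → ∃ c ∈ C, v ∈ c := by
    intro v hvU hvW
    obtain ⟨l, hl, hvl⟩ := (h.mem_iff v).1 hvU
    rcases Finset.mem_union.1 hl with hl | hl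
    · exact absurd (hP (Finset.mem_biUnion.2 ⟨l, hl, List.mem_toFinset.2 hvl⟩)) hvW
    · exact ⟨l, hl, hvl⟩
  obtain ⟨v, hvU, hvW⟩ := Finset.not_subset.1 hUW
  obtain ⟨c, hc, hvc⟩ := hcirc v hvU hvW
  obtain ⟨y, hyW, hentry⟩ := (hB.circles c hc v hvc).exists_entry hvW
  have hgrow : ∀ W', y ∈ W' → (Finset.univ \ (W ∪ W')).card < k := by
    intro W' hy
    rw [← hk]
    refine Finset.card_lt_card (Finset.ssubset_iff_of_subset ?_ |>.2 ⟨y, ?_, ?_⟩)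
    · exact Finset.sdiff_subset_sdiff (Finset.Subset.refl _) Finset.subset_union_left
    · simpa using hyW
    · simp [hy]
  by_cases hyU : y ∈ U
  · -- the entered node lies on a circle: add this circle
    obtain ⟨d, hd, hyd⟩ := hcirc y hyU hyW
    have hdW : ∀ u ∈ d, u ∉ W := fun u hu huW => hyW (hC d hd ⟨u, hu, huW⟩ y hyd)
    obtain ⟨q, hq0, hinj, hadj, hlast, himg⟩ := exists_circle_enumeration (D := stateDigraph A)
      (h.nodup d (Finset.mem_union_right _ hd))
      (fun a b hab => hA a b ((h.edge_iff a b).2 (Or.inr ⟨d, hd, hab⟩))) hyd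
    have hn : 0 < d.length := List.length_pos_of_mem hyd
    have hqd : ∀ i < d.length, q i ∈ d := fun i hi => by
      rw [← List.mem_toFinset, ← himg]
      exact Finset.mem_image_of_mem q (Finset.mem_range.2 hi)
    obtain ⟨A₁, B₁, h₁⟩ := h₀.extend hn hinj (fun i hi => hdW _ (hqd i hi))
      (fun i _ => hadj i) (Or.inr (by
        have := hadj (d.length - 1)
        rwa [Nat.sub_add_cancel hn, hlast] at this)) (hq0 ▸ hentry)
    rw [himg] at h₁
    refine ih _ (hgrow d.toFinset (List.mem_toFinset.2 hyd)) _ A₁ B₁ rfl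
      (hP.trans Finset.subset_union_left) h₁ ?_
    rintro c hc ⟨u, huc, hu⟩ x hx
    rcases Finset.mem_union.1 hu with hu | hu
    · exact Finset.mem_union_left _ (hC c hc ⟨u, huc, hu⟩ x hx)
    · obtain rfl := h.eq_of_mem c (Finset.mem_union_right _ hc) d (Finset.mem_union_right _ hd) u
        huc (List.mem_toFinset.1 hu)
      exact Finset.mem_union_right _ (List.mem_toFinset.2 hx)
  · -- the entered node is not covered: add this node alone
    obtain ⟨A₁, B₁, h₁⟩ := h₀.extend (n := 1) one_pos (q := fun _ => y) (by intros; omega)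
      (fun _ _ => hyW) (by intros; omega) (Or.inl fun _ _ => hyU) hentry
    have himg : (Finset.range 1).image (fun _ => y) = {y} := by simp
    rw [himg] at h₁
    refine ih _ (hgrow {y} (Finset.mem_singleton_self y)) _ A₁ B₁ rfl
      (hP.trans Finset.subset_union_left) h₁ ?_
    rintro c hc ⟨u, huc, hu⟩ x hx
    rcases Finset.mem_union.1 hu with hu | hu
    · exact Finset.mem_union_left _ (hC c hc ⟨u, huc, hu⟩ x hx)
    · rw [Finset.mem_singleton] at hu
      exact absurd ((h.mem_iff y).2 ⟨c, Finset.mem_union_right _ hc, hu ▸ huc⟩) hyU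

end IsDecomposition

end Growth

/-! ### From independent responses to structural controllability -/

section Controllability

variable {V : Type*} [Fintype V] [DecidableEq V] {ι : Type*}

/-- By the Cayley–Hamilton theorem, the first `N` powers of `A` decide. -/
theorem sum_pow_mul_eq_zero {A : Matrix V V ℝ} {B : Matrix V ι ℝ} {w : V → ℝ} {m : ι}
    (h : ∀ k < Fintype.card V, ∑ v, w v * (A ^ k * B) v m = 0) (k : ℕ) :
    ∑ v, w v * (A ^ k * B) v m = 0 := by
  have hlin : ∀ p : Polynomial ℝ, ∑ v, w v * (Polynomial.aeval A p * B) v m =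
      ∑ j ∈ p.support, p.coeff j * ∑ v, w v * (A ^ j * B) v m := by
    intro p
    rw [Polynomial.aeval_def, Polynomial.eval₂_eq_sum, Polynomial.sum]
    simp only [← Algebra.smul_def, Matrix.sum_mul, Matrix.sum_apply, Matrix.smul_mul,
      Matrix.smul_apply, smul_eq_mul, Finset.mul_sum]
    rw [Finset.sum_comm]
    exact Finset.sum_congr rfl fun j _ => Finset.sum_congr rfl fun v _ => by ring
  rw [Matrix.pow_eq_aeval_mod_charpoly, hlin]
  refine Finset.sum_eq_zero fun j hj => ?_
  rw [h j, mul_zero]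
  have h1 := (Polynomial.le_degree_of_mem_supp j hj).trans_lt
    (Polynomial.degree_modByMonic_lt _ A.charpoly_monic)
  rw [Matrix.charpoly_degree_eq_dim] at h1
  exact_mod_cast h1

theorem outputControllabilityMatrix_apply (A : Matrix V V ℝ) (B : Matrix V ι ℝ) (S : Finset V)
    (i : S) (p : Fin (Fintype.card V) × ι) :
    outputControllabilityMatrix A B S i p = (A ^ (p.1 : ℕ) * B) i p.2 := by
  have h : outputMatrix S * A ^ (p.1 : ℕ) = (A ^ (p.1 : ℕ)).submatrix Subtype.val id := by
    ext i j
    simp [outputMatrix, Matrix.mul_apply, Matrix.one_apply]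
  rw [outputControllabilityMatrix, Matrix.of_apply, h]
  rfl

theorem IsIndependentSubsystem.linearIndependent_rows {A A₀ : Matrix V V ℝ} {B B₀ : Matrix V ι ℝ}
    {U W S : Finset V} (h : IsIndependentSubsystem A B U W A₀ B₀) (hUW : U ⊆ W) (hS : S ⊆ U) :
    LinearIndependent ℝ (outputControllabilityMatrix A₀ B₀ S).row := by
  rw [Fintype.linearIndependent_iff]
  intro g hg
  let w : V → ℝ := fun v => if hv : v ∈ S then g ⟨v, hv⟩ else 0
  have hsum : ∀ φ : V → ℝ, ∑ v, w v * φ v = ∑ i : S, g i * φ i := by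
    intro φ
    rw [← Finset.sum_subset (Finset.subset_univ S), ← Finset.sum_coe_sort S]
    · exact Finset.sum_congr rfl fun i _ => by simp [w]
    · intro v _ hv
      simp [w, hv]
  have hw := h.independent w
    (fun v hv => dif_neg fun hvS => hv (Finset.mem_inter.2 ⟨hS hvS, hUW (hS hvS)⟩))
    (fun m => by
      ext k
      simp only [response, map_sum, PowerSeries.coeff_C_mul, PowerSeries.coeff_mk, map_zero]
      refine sum_pow_mul_eq_zero (fun k hk => ?_) k
      rw [hsum fun v => (A₀ ^ k * B₀) v m]
      have h1 := congrFun hg (⟨k, hk⟩, m)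
      simpa [Matrix.row, outputControllabilityMatrix_apply] using h1)
  intro i
  simpa [w] using hw i

/-- If `X₀` vanishes wherever `X` does, then `X₀ + ε X` has the structure of `X` for all small
`ε ≠ 0`. -/
theorem eventually_sameStructure {α β : Type*} [Finite α] [Finite β] {X X₀ : Matrix α β ℝ}
    (h : ∀ i j, X i j = 0 → X₀ i j = 0) :
    ∀ᶠ ε in nhdsWithin (0 : ℝ) {0}ᶜ, SameStructure X (X₀ + ε • X) := by
  simp only [SameStructure, Filter.eventually_all]
  intro i j
  by_cases hX : X i j = 0
  · simp [hX, h i j hX]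
  · simp only [hX, false_iff, Matrix.add_apply, Matrix.smul_apply, smul_eq_mul]
    by_cases hX₀ : X₀ i j = 0
    · filter_upwards [self_mem_nhdsWithin] with ε hε
      rw [hX₀, zero_add]
      exact mul_ne_zero hε hX
    · refine Filter.Eventually.filter_mono nhdsWithin_le_nhds ?_
      have hcont : Continuous fun ε : ℝ => X₀ i j + ε * X i j := by fun_prop
      exact hcont.continuousAt.eventually_ne (by simpa using hX₀)

/-- Linear independence is an open condition, so a small multiple of `(A, B)` can be added to the
subsystem in order to restore the connections that it does not use. -/
theorem IsIndependentSubsystem.structurallyTargetControllable [Fintype ι] {A A₀ : Matrix V V ℝ}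
    {B B₀ : Matrix V ι ℝ} {U W S : Finset V} (h : IsIndependentSubsystem A B U W A₀ B₀)
    (hUW : U ⊆ W) (hS : S ⊆ U) : StructurallyTargetControllable A B S := by
  have hcont : Continuous fun ε : ℝ =>
      (outputControllabilityMatrix (A₀ + ε • A) (B₀ + ε • B) S).row := by
    refine continuous_pi fun i => continuous_pi fun p => ?_
    simp only [Matrix.row, outputControllabilityMatrix_apply]
    exact (((continuous_const.add (continuous_id.smul continuous_const)).pow _).matrix_mul
      (continuous_const.add (continuous_id.smul continuous_const))).matrix_elem _ _
  have hopen : IsOpen {r : S → Fin (Fintype.card V) × ι → ℝ | LinearIndependent ℝ r} :=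
    isOpen_setOfPred_linearIndependent
  have h0 : LinearIndependent ℝ
      (outputControllabilityMatrix (A₀ + (0 : ℝ) • A) (B₀ + (0 : ℝ) • B) S).row := by
    simpa only [zero_smul, add_zero] using h.linearIndependent_rows hUW hS
  have hev : ∀ᶠ ε in nhdsWithin (0 : ℝ) {0}ᶜ, LinearIndependent ℝ
      (outputControllabilityMatrix (A₀ + ε • A) (B₀ + ε • B) S).row :=
    Filter.Eventually.filter_mono nhdsWithin_le_nhds
      (hcont.continuousAt.eventually (hopen.mem_nhds h0))
  obtain ⟨ε, h1, h2, h3⟩ := ((eventually_sameStructure h.state).and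
    ((eventually_sameStructure h.input).and hev)).exists
  refine ⟨A₀ + ε • A, B₀ + ε • B, h1, h2, ?_⟩
  rw [TargetControllable, h3.rank_matrix, Fintype.card_coe]

end Controllability

/-! ### Attaching control sources -/

section Sources

variable {V : Type*} [Fintype V] [DecidableEq V]

/-- Each path gets a control source at its first node, and the source number `0` is also connected
to all nodes on circles. -/
theorem exists_controlSourcesAttached (A : Matrix V V ℝ) (P C : Finset (List V)) :
    ∃ B : Matrix V (Fin (max P.card 1)) ℝ, ControlSourcesAttached A B P C := by
  classical
  let σ : P → Fin (max P.card 1) := fun p => Fin.castLE (le_max_left _ _) (P.equivFin p)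
  let m₀ : Fin (max P.card 1) := ⟨0, lt_max_of_lt_right one_pos⟩
  refine ⟨fun v m => if (∃ p : P, p.1.head? = some v ∧ σ p = m) ∨
    (m = m₀ ∧ ∃ c ∈ C, v ∈ c) then 1 else 0, ⟨σ, ?_, fun p v hv => ?_⟩, fun c hc v hv => ?_⟩
  · exact (Fin.castLE_injective _).comp P.equivFin.injective
  · rw [if_pos (Or.inl ⟨p, hv, rfl⟩)]
    exact one_ne_zero
  · refine ⟨m₀, Relation.ReflTransGen.single ?_⟩
    change ite _ _ _ ≠ (0 : ℝ)
    rw [if_pos (Or.inr ⟨rfl, c, hc, hv⟩)]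
    exact one_ne_zero

end Sources

end TargetControl

theorem theorem1 {V : Type*} [Fintype V] [DecidableEq V] (A : Matrix V V ℝ) (S : Finset V)
    (f : TargetControl.SplitNode V → TargetControl.SplitNode V → ℝ)
    (hf : TargetControl.IsFeasibleCirculation
      (TargetControl.splitNetwork (TargetControl.stateDigraph A) S) f) :
    ∃ P C : Finset (List V),
      -- disjoint simple paths and circles of the network that cover the target set
      TargetControl.IsPathCircleSystem (TargetControl.stateDigraph A) P C ∧
      S ⊆ TargetControl.cover (P ∪ C) ∧
      -- they come from `f`: their flow is `f` rounded, and `f` itself if `f` is integral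
      (∀ a b, TargetControl.splitArc (TargetControl.stateDigraph A) a b →
        ⌊f a b⌋ ≤ (TargetControl.inducedFlow P C a b : ℤ) ∧
          (TargetControl.inducedFlow P C a b : ℤ) ≤ ⌈f a b⌉) ∧
      -- `max {|P|, 1}` control sources can be attached to the paths and circles
      (∃ B : Matrix V (Fin (max P.card 1)) ℝ, TargetControl.ControlSourcesAttached A B P C) ∧
      -- whenever control sources are attached, the target set is structurally controllable
      (∀ (M : ℕ) (B : Matrix V (Fin M) ℝ), TargetControl.ControlSourcesAttached A B P C →
        TargetControl.StructurallyTargetControllable A B S) := by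

  obtain ⟨U, E, P, C, h, hE, hSU, hflow⟩ :=
    TargetControl.exists_isDecomposition_of_feasible _ S f hf
  refine ⟨P, C, h.isPathCircleSystem hE, h.cover_eq.symm ▸ hSU, hflow,
    TargetControl.exists_controlSourcesAttached A P C, fun M B hB => ?_⟩
  obtain ⟨W, A₀, B₀, hUW, hsub⟩ := h.exists_subsystem hE hB
  exact hsub.structurallyTargetControllable hUW hSU
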